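/- For a vector $\mathbf v\in\mathbb Z_4^n$, its type is $(t_0,t_1,t_2,t_3)$, where $t_k$ is the number of coordinates of $\mathbf v$ equal to $k$. Let $r,s$ be integers with $r\ge s\ge 1$ and $r$ even, and put $n=2(r+s)$. Let $S\subset\mathbb Z_4^n$ be the set of all vectors of type $(r,s,r,s)$, and let $G(r,s)=\mathrm{Cay}(\mathbb Z_4^n,S)$ be the graph with vertex set $\mathbb Z_4^n$ in which $\mathbf v,\mathbf w$ are adjacent if and only if $\mathbf v-\mathbf w\in S$. For $\mathbf v\in\mathbb Z_4^n$ let $$\lambda(\mathbf v)=\sum_{\mathbf x\in S} i^{\,\mathbf v\cdot\mathbf x},$$ and write $\lambda(t_0,t_1,t_2,t_3)$ for the value of $\lambda(\mathbf v)$ at vectors $\mathbf v$ of type $(t_0,t_1,t_2,t_3)$ (it depends only on the type). Then the smallest eigenvalue of (the adjacency matrix of) $G(r,s)$ is $$\lambda_{\min}(G(r,s))=\lambda(0,1,n-2,1)=-\frac{1}{n-1}\binom{n}{r,s,r,s},\qquad \binom{n}{r,s,r,s}=\frac{n!}{(r!)^2(s!)^2},$$ in each of the following two regimes: (R1) $s\ge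 2$ is fixed and $n$ is large enough, that is, for every integer $s\ge2$ there is $N=N(s)$ such that the formula holds for all even $r\ge s$ with $n=2(r+s)\ge N$; (R2) $s=\alpha n/2$ with $0<\alpha\le 0.17$ fixed and $n$ is large enough, that is, for every real $\alpha$ with $0<\alpha\le0.17$ there is $N=N(\alpha)$ such that the formula holds for all $r\ge s$ with $r$ even, $n=2(r+s)\ge N$ and $s=\alpha n/2$. -/

import Mathlib

/-- The `k`-th Hamming weight of `v ∈ ℤ_p^n`: the number of coordinates of `v` equal to `k`. -/
def hammingWt {p n : ℕ} (k : ZMod p) (v : Fin n → ZMod p) : ℕ :=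
  (Finset.univ.filter fun i => v i = k).card

/-- The set `ℤ_p(t)` of vectors of type `t = (t_0, …, t_{p-1})` in `ℤ_p^n`: each symbol `k` occurs
exactly `t_k` times. -/
def vectorsOfType (p n : ℕ) (t : Fin p → ℕ) : Set (Fin n → ZMod p) :=
  {v | ∀ k : Fin p, hammingWt ((k : ℕ) : ZMod p) v = t k}

/-- The Cayley graph `Cay(ℤ_p^n, t)` generated by the vectors of type `t`. -/
def typeCayley (p n : ℕ) (t : Fin p → ℕ) : SimpleGraph (Fin n → ZMod p) :=
  SimpleGraph.addCayley (vectorsOfType p n t)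

open Classical in
/-- The character sum `λ(v) = ∑_{x ∈ ℤ_p(t)} ζ_p^{v · x}` with `ζ_p = exp(2πi/p)`. -/
noncomputable def charSum (p n : ℕ) [NeZero p] (t : Fin p → ℕ) (v : Fin n → ZMod p) : ℂ :=
  ∑ x ∈ Finset.univ.filter (fun x => x ∈ vectorsOfType p n t), ZMod.stdAddChar (v ⬝ᵥ x)

open Classical in
/-- The eigenvalues of a finite graph, i.e. of its adjacency matrix over `ℝ`. -/
def graphEigenvalues {V : Type*} [Fintype V] (G : SimpleGraph V) : Set ℝ :=
  {μ | Module.End.HasEigenvalue (Matrix.mulVecLin (G.adjMatrix ℝ)) μ}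

/-! The generating set S is symmetric, so G(r,s) is diagonalized by characters and its spectrum is
the set of sums λ(v). Since r is even, every x in S has coordinate sum 0 mod 4, so λ is unchanged
when a constant vector is added to v. One may therefore assume that at most half of the coordinates
of v are odd, and can move type (0,1,n-2,1) to e_a - e_b, where a symmetry argument gives exactly
-|S|/(n-1).

Suppose v has k > 0 odd coordinates. Split x into its parities and its upper binary digits: i^(v·x)
is a unimodular factor depending only on the parities, times a product of k upper-digit signs. For
fixed parities the signs are balanced on the odd and on the even coordinates of x, so their sum is a
product of two central Krawtchouk values, whose sign depends only on k. The triangle inequality over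
the parity classes thus costs nothing and gives |λ(v)| ≤ |S| |K_k(n/2)| / C(n,k)
(`norm_charSum_le`), which is at most |S|/(n-1) for even k with 0 < k ≤ n/2, and zero for odd k.

If v has no odd coordinate and t twos, λ(v) = |S| K_{2s}(t)/C(n,2s) (`charSum_of_even`). Here size
matters: the three-term recurrence keeps the value positive for large |n - 2t|, and otherwise a
geometric envelope brings it below 1/(n-1) in absolute value (`exists_krawtchoukSeq_lower_fixed`,
`exists_krawtchoukSeq_lower_linear`). -/

/-! ### Normalized Krawtchouk values from their recurrence -/

/-- The sequence `d ↦ K_d(t) / C(n, d)` of normalized binary Krawtchouk values, as a function of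
`z = n - 2t`, defined by its three-term recurrence. -/
noncomputable def krawtchoukSeq (n z : ℝ) : ℕ → ℝ
  | 0 => 1
  | 1 => z / n
  | (d + 2) => (z * krawtchoukSeq n z (d + 1) - (d + 1) * krawtchoukSeq n z d) / (n - (d + 1))

lemma krawtchoukSeq_zero (n z : ℝ) : krawtchoukSeq n z 0 = 1 := by
  simp [krawtchoukSeq]

lemma krawtchoukSeq_one (n z : ℝ) : krawtchoukSeq n z 1 = z / n := by
  simp [krawtchoukSeq]

lemma krawtchoukSeq_add_two (n z : ℝ) (d : ℕ) :
    krawtchoukSeq n z (d + 2) =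
      (z * krawtchoukSeq n z (d + 1) - (d + 1) * krawtchoukSeq n z d) / (n - (d + 1)) := by
  rw [krawtchoukSeq]

lemma krawtchoukSeq_neg (n z : ℝ) (d : ℕ) :
    krawtchoukSeq n (-z) d = (-1) ^ d * krawtchoukSeq n z d := by
  induction d using Nat.twoStepInduction with
  | zero => simp [krawtchoukSeq_zero]
  | one => simp [krawtchoukSeq_one, neg_div]
  | more d h0 h1 =>
    rw [krawtchoukSeq_add_two, krawtchoukSeq_add_two, h0, h1]
    ring

/-- With `z = 0` the odd terms vanish and the even terms alternate in sign. -/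
lemma krawtchoukSeq_zero_odd (n : ℝ) (m : ℕ) : krawtchoukSeq n 0 (2 * m + 1) = 0 := by
  induction m with
  | zero => simp [krawtchoukSeq_one]
  | succ m ih =>
    rw [show 2 * (m + 1) + 1 = (2 * m + 1) + 2 by ring, krawtchoukSeq_add_two, ih]
    simp

lemma krawtchoukSeq_zero_even_sign (n : ℝ) (m : ℕ) (h : (2 * m : ℝ) ≤ n) :
    0 ≤ (-1) ^ m * krawtchoukSeq n 0 (2 * m) := by
  induction m with
  | zero => simp [krawtchoukSeq_zero]
  | succ m ih =>
    push_cast at h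
    have ih := ih (by linarith)
    rw [show 2 * (m + 1) = 2 * m + 2 by ring, krawtchoukSeq_add_two]
    have : (-1 : ℝ) ^ (m + 1) * ((0 * krawtchoukSeq n 0 (2 * m + 1) -
        (((2 * m : ℕ) : ℝ) + 1) * krawtchoukSeq n 0 (2 * m)) / (n - (((2 * m : ℕ) : ℝ) + 1))) =
        ((-1) ^ m * krawtchoukSeq n 0 (2 * m)) * ((2 * m + 1) / (n - (2 * m + 1))) := by
      push_cast; ring
    rw [this]
    exact mul_nonneg ih (div_nonneg (by positivity) (by linarith))

/-- At z = 0 the recurrence multiplies the absolute value by (2m+1)/(n-2m-1), at most 1 up to the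
middle, so the first value 1/(n-1), at degree 2, is the largest. -/
lemma abs_krawtchoukSeq_zero_even_le (n : ℝ) (m : ℕ) (hm : 1 ≤ m) (h : (4 * m : ℝ) ≤ n) :
    |krawtchoukSeq n 0 (2 * m)| ≤ 1 / (n - 1) := by
  induction m, hm using Nat.le_induction with
  | base =>
    norm_num at h
    rw [show 2 * 1 = 0 + 2 by rfl, krawtchoukSeq_add_two, krawtchoukSeq_zero]
    simp only [zero_mul, CharP.cast_eq_zero, zero_add, mul_one, zero_sub, abs_div, abs_neg, abs_one]
    rw [abs_of_pos (by linarith)]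
  | succ m hm ih =>
    push_cast at h
    have ih := ih (by linarith)
    have hm' : (1 : ℝ) ≤ m := by exact_mod_cast hm
    rw [show 2 * (m + 1) = 2 * m + 2 by ring, krawtchoukSeq_add_two, zero_mul, zero_sub, abs_div,
      abs_neg, abs_mul]
    push_cast
    rw [abs_of_pos (by linarith : (0 : ℝ) < 2 * m + 1),
      abs_of_pos (by linarith : (0 : ℝ) < n - (2 * m + 1)), div_le_iff₀ (by linarith)]
    have h1 : (0 : ℝ) < 1 / (n - 1) := by apply one_div_pos.2; linarith
    nlinarith [abs_nonneg (krawtchoukSeq n 0 (2 * m))]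

/-- The terms stay positive in the non-oscillating range of the recurrence. -/
lemma krawtchoukSeq_pos {n z : ℝ} {d : ℕ} (hz : 0 < z) (hd : (d : ℝ) ≤ n) (hd1 : 1 ≤ d)
    (h : ∀ j : ℕ, 1 ≤ j → j + 1 ≤ d → 4 * (j : ℝ) * (n - j + 1) ≤ z ^ 2) :
    0 < krawtchoukSeq n z d := by
  -- The induction carries the ratio bound p_{j+1}/p_j ≥ z/(2(n-j)): by it and the hypothesis on z²,
  -- the subtracted term of the recurrence is at most half of the leading one.
  have key : ∀ j : ℕ, j + 1 ≤ d → 0 < krawtchoukSeq n z j ∧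
      z * krawtchoukSeq n z j ≤ 2 * (n - j) * krawtchoukSeq n z (j + 1) := by
    intro j
    induction j with
    | zero =>
      intro _
      have hn : 0 < n := lt_of_lt_of_le (by exact_mod_cast hd1) hd
      rw [krawtchoukSeq_zero, krawtchoukSeq_one]
      refine ⟨one_pos, ?_⟩
      have : 2 * (n - ((0 : ℕ) : ℝ)) * (z / n) = 2 * z := by
        field_simp; simp
      rw [this]; linarith
    | succ j ih =>
      intro hj
      obtain ⟨h0, h1⟩ := ih (by omega)
      have hjd : (j : ℝ) + 1 + 1 ≤ d := by exact_mod_cast hj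
      have hpos : 0 < krawtchoukSeq n z (j + 1) := by
        have : 0 < 2 * (n - j) * krawtchoukSeq n z (j + 1) := lt_of_lt_of_le (mul_pos hz h0) h1
        exact pos_of_mul_pos_right this (by linarith)
      refine ⟨hpos, ?_⟩
      have hq := h (j + 1) (by omega) hj
      push_cast at hq ⊢
      rw [show j + 1 + 1 = j + 2 by ring, krawtchoukSeq_add_two]
      have hne : n - ((j : ℝ) + 1) ≠ 0 := by
        have : 0 < n - ((j : ℝ) + 1) := by linarith
        exact this.ne'
      rw [mul_assoc, mul_div_cancel₀ _ hne]
      have hA : z * ((j + 1) * krawtchoukSeq n z j) ≤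
          z * (z / 2 * krawtchoukSeq n z (j + 1)) := by
        calc z * ((j + 1) * krawtchoukSeq n z j) = (j + 1) * (z * krawtchoukSeq n z j) := by ring
          _ ≤ (j + 1) * (2 * (n - j) * krawtchoukSeq n z (j + 1)) := by gcongr
          _ = (4 * (j + 1) * (n - (j + 1) + 1)) / 2 * krawtchoukSeq n z (j + 1) := by ring
          _ ≤ z ^ 2 / 2 * krawtchoukSeq n z (j + 1) := by gcongr
          _ = _ := by ring
      have hB := le_of_mul_le_mul_left hA hz
      linarith
  obtain ⟨e, rfl⟩ : ∃ e, d = e + 1 := ⟨d - 1, by omega⟩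
  obtain ⟨h0, h1⟩ := key e le_rfl
  push_cast at hd
  exact pos_of_mul_pos_right (lt_of_lt_of_le (mul_pos hz h0) h1) (by linarith)

/-- A geometric envelope propagates along the recurrence. -/
lemma abs_krawtchoukSeq_le_geometric {n z θ B : ℝ} {a b : ℕ} (hz : 0 ≤ z) (hB : 0 ≤ B)
    (hθ : 0 ≤ θ) (hb : (b : ℝ) ≤ n)
    (h0 : |krawtchoukSeq n z a| ≤ B) (h1 : |krawtchoukSeq n z (a + 1)| ≤ B * θ)
    (h : ∀ j : ℕ, j + 1 < b → z * θ + (j + 1) ≤ (n - (j + 1)) * θ ^ 2) (i : ℕ) (hi : a + i ≤ b) :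
    |krawtchoukSeq n z (a + i)| ≤ B * θ ^ i := by
  induction i using Nat.twoStepInduction with
  | zero => simpa using h0
  | one => simpa using h1
  | more i ih0 ih1 =>
    have ih0 := ih0 (by omega)
    have ih1 := ih1 (by omega)
    have hj := h (a + i) (by omega)
    have hlt : ((a + i : ℕ) : ℝ) + 1 + 1 ≤ n := le_trans (by exact_mod_cast hi) hb
    rw [show a + (i + 2) = (a + i) + 2 by ring, krawtchoukSeq_add_two, abs_div,
      abs_of_pos (by linarith : (0 : ℝ) < n - (((a + i : ℕ) : ℝ) + 1)), div_le_iff₀ (by linarith)]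
    calc |z * krawtchoukSeq n z (a + i + 1) - (((a + i : ℕ) : ℝ) + 1) * krawtchoukSeq n z (a + i)|
        ≤ |z * krawtchoukSeq n z (a + i + 1)| +
          |(((a + i : ℕ) : ℝ) + 1) * krawtchoukSeq n z (a + i)| := abs_sub _ _
      _ = z * |krawtchoukSeq n z (a + i + 1)| +
          (((a + i : ℕ) : ℝ) + 1) * |krawtchoukSeq n z (a + i)| := by
        rw [abs_mul, abs_mul, abs_of_nonneg hz,
          abs_of_nonneg (by positivity : (0 : ℝ) ≤ ((a + i : ℕ) : ℝ) + 1)]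
      _ ≤ z * (B * θ ^ (i + 1)) + (((a + i : ℕ) : ℝ) + 1) * (B * θ ^ i) := by
        gcongr; exact ih1
      _ = B * θ ^ i * (z * θ + (((a + i : ℕ) : ℝ) + 1)) := by ring
      _ ≤ B * θ ^ i * ((n - (((a + i : ℕ) : ℝ) + 1)) * θ ^ 2) := by gcongr
      _ = _ := by ring

/-- For a lower bound on an even term it suffices to bound the term in the oscillating range. -/
lemma krawtchoukSeq_lower_of_oscillating {n : ℝ} {s : ℕ} (hn : 1 < n) (hs : 1 ≤ s)
    (hsn : (4 * s : ℝ) ≤ n)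
    (h : ∀ z : ℝ, 0 ≤ z → z ≤ n → z ^ 2 < 4 * (2 * s - 1) * (n - 2 * s + 2) →
      |krawtchoukSeq n z (2 * s)| ≤ 1 / (n - 1))
    (z : ℝ) (hz : |z| ≤ n) : -(1 / (n - 1)) ≤ krawtchoukSeq n z (2 * s) := by
  wlog h0 : 0 ≤ z generalizing z
  · have := this (-z) (by simpa using hz) (by linarith)
    rwa [krawtchoukSeq_neg, Even.neg_one_pow (by simp), one_mul] at this
  rw [abs_of_nonneg h0] at hz
  have hs' : (1 : ℝ) ≤ s := by exact_mod_cast hs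
  by_cases hosc : z ^ 2 < 4 * (2 * s - 1) * (n - 2 * s + 2)
  · exact (abs_le.1 (h z h0 hz hosc)).1
  · push Not at hosc
    have hz0 : 0 < z := by
      rcases h0.lt_or_eq with h0 | h0
      · exact h0
      · rw [← h0] at hosc; nlinarith
    have hpos := krawtchoukSeq_pos (n := n) (z := z) (d := 2 * s) hz0 (by push_cast; linarith)
      (by omega) (by
        intro j hj1 hj
        have hj' : (j : ℝ) + 1 ≤ 2 * s := by exact_mod_cast hj
        -- j(n+1-j) increases up to the middle, so j = 2s-1 is the worst case; the product supplied
        -- is the difference of the two values.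
        nlinarith [mul_nonneg (by linarith : (0 : ℝ) ≤ 2 * s - 1 - j)
          (by linarith : (0 : ℝ) ≤ n + 1 - (2 * s - 1) - j)])
    have : 0 < 1 / (n - 1) := by apply one_div_pos.2; linarith
    linarith

/-! ### Lower bounds in the two regimes -/

lemma exists_krawtchoukSeq_lower_fixed (s : ℕ) (hs : 2 ≤ s) :
    ∃ N : ℕ, ∀ n : ℕ, N ≤ n → ∀ z : ℝ, |z| ≤ n →
      -(1 / ((n : ℝ) - 1)) ≤ krawtchoukSeq n z (2 * s) := by
  -- The envelope below has θ² = 50s/n, so θ^(2s) ≤ (50s/n)² = (2500s²/n)(1/n); the exponent 2 is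
  -- where s ≥ 2 enters.
  refine ⟨2500 * s ^ 2, fun n hn => ?_⟩
  have hs' : (2 : ℝ) ≤ s := by exact_mod_cast hs
  have hn' : 2500 * (s : ℝ) ^ 2 ≤ n := by exact_mod_cast hn
  have hns : 2500 * (s : ℝ) ≤ n := by nlinarith
  refine krawtchoukSeq_lower_of_oscillating (by linarith) (by omega) (by linarith) ?_
  intro z hz hzn hosc
  -- In the oscillating range z² ≤ 8sn, so zθ ≤ 20s; together with j+1 ≤ 2s this stays below (n/2)θ²
  -- = 25s.
  set θ : ℝ := Real.sqrt (50 * s / n) with hθ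
  have hnpos : (0 : ℝ) < n := by linarith
  have hθ2 : θ ^ 2 = 50 * s / n := Real.sq_sqrt (by positivity)
  have hθ0 : 0 ≤ θ := Real.sqrt_nonneg _
  have hzsq : z ^ 2 ≤ 8 * s * n := by nlinarith
  have hzθ : z * θ ≤ 20 * s := by
    refine (pow_le_pow_iff_left₀ (by positivity) (by linarith) two_ne_zero).1 ?_
    rw [mul_pow, hθ2]
    calc z ^ 2 * (50 * s / n) ≤ 8 * s * n * (50 * s / n) := by gcongr
      _ = (20 * s) ^ 2 := by field_simp; ring
  have hz1 : z / n ≤ θ := by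
    refine (pow_le_pow_iff_left₀ (by positivity) hθ0 two_ne_zero).1 ?_
    rw [hθ2, div_pow, div_le_div_iff₀ (by positivity) hnpos]
    nlinarith
  have hbound := abs_krawtchoukSeq_le_geometric (n := n) (z := z) (θ := θ) (B := 1) (a := 0)
    (b := 2 * s) hz zero_le_one hθ0 (by push_cast; linarith) (by simp [krawtchoukSeq_zero])
    (by rw [zero_add, krawtchoukSeq_one, one_mul, abs_of_nonneg (by positivity)]; exact hz1)
    (by
      intro j hj
      have hj' : (j : ℝ) + 1 ≤ 2 * s := by exact_mod_cast hj.le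
      rw [hθ2]
      have : (n - ((j : ℝ) + 1)) * (50 * s / n) ≥ (n / 2) * (50 * s / n) := by
        gcongr; linarith
      have h2 : ((n : ℝ) / 2) * (50 * s / n) = 25 * s := by field_simp; ring
      linarith) (2 * s) (by omega)
  rw [zero_add, one_mul, pow_mul, hθ2] at hbound
  refine hbound.trans ?_
  have h1 : 50 * (s : ℝ) / n ≤ 1 := by rw [div_le_one hnpos]; linarith
  calc (50 * (s : ℝ) / n) ^ s ≤ (50 * (s : ℝ) / n) ^ 2 :=
        pow_le_pow_of_le_one (by positivity) h1 hs
    _ = 2500 * s ^ 2 / n * (1 / n) := by ring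
    _ ≤ 1 * (1 / n) := by
      gcongr; rw [div_le_one hnpos]; exact hn'
    _ ≤ 1 / (n - 1) := by
      rw [one_mul]; apply one_div_le_one_div_of_le <;> linarith

lemma abs_krawtchoukSeq_le_of_two_mul {n m : ℕ} {z : ℝ} (hz : 0 ≤ z) (hm : 50 * m ≤ n)
    (hm1 : 1 ≤ m) (hzn : z ≤ 0.7513 * n) (i : ℕ) (hi : i ≤ 2 * m) :
    |krawtchoukSeq n z i| ≤ 0.84 ^ i := by
  have hm' : 50 * (m : ℝ) ≤ n := by exact_mod_cast hm
  have hm1' : (1 : ℝ) ≤ m := by exact_mod_cast hm1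
  have := abs_krawtchoukSeq_le_geometric (n := n) (z := z) (θ := 0.84) (B := 1) (a := 0)
    (b := 2 * m) hz zero_le_one (by norm_num) (by push_cast; linarith) (by simp [krawtchoukSeq_zero])
    (by
      rw [zero_add, krawtchoukSeq_one, one_mul, abs_of_nonneg (by positivity),
        div_le_iff₀ (by linarith)]
      linarith)
    (by
      intro j hj
      have hj' : (j : ℝ) + 1 ≤ 2 * m := by exact_mod_cast hj.le
      linarith) i (by omega)
  simpa using this

lemma abs_krawtchoukSeq_le_of_six_mul {n m : ℕ} {z : ℝ} (hz : 0 ≤ z) (hm : 50 * m ≤ n)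
    (hm1 : 1 ≤ m) (hzn : z ≤ 0.7513 * n) (i : ℕ) (hi : 2 * m ≤ i + 1) (hi' : i ≤ 6 * m) :
    |krawtchoukSeq n z i| ≤ 0.84 ^ (2 * m - 1) := by
  have hm' : 50 * (m : ℝ) ≤ n := by exact_mod_cast hm
  have hm1' : (1 : ℝ) ≤ m := by exact_mod_cast hm1
  -- The envelope needs two consecutive starting values; 2m-1 and 2m are the last two controlled by
  -- the decaying stage.
  have := abs_krawtchoukSeq_le_geometric (n := n) (z := z) (θ := 1) (B := 0.84 ^ (2 * m - 1))
    (a := 2 * m - 1) (b := 6 * m) hz (by positivity) zero_le_one (by push_cast; linarith)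
    (abs_krawtchoukSeq_le_of_two_mul hz hm hm1 hzn _ (by omega))
    (by
      refine (abs_krawtchoukSeq_le_of_two_mul hz hm hm1 hzn _ (by omega)).trans ?_
      rw [mul_one]
      exact pow_le_pow_of_le_one (by norm_num) (by norm_num) (by omega))
    (by
      intro j hj
      have hj' : (j : ℝ) + 1 ≤ 6 * m := by exact_mod_cast hj.le
      linarith) (i - (2 * m - 1)) (by omega)
  rwa [show 2 * m - 1 + (i - (2 * m - 1)) = i by omega, one_pow, mul_one] at this

lemma abs_krawtchoukSeq_le_of_ge_six_mul {n m : ℕ} {z : ℝ} (hz : 0 ≤ z) (hm : 50 * m ≤ n)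
    (hm1 : 1 ≤ m) (hzn : z ≤ 0.7513 * n) (i : ℕ) (hi : 6 * m ≤ i) (hi' : (i : ℝ) ≤ 0.17 * n) :
    |krawtchoukSeq n z i| ≤ 0.84 ^ (2 * m - 1) * 1.094 ^ (i - (6 * m - 1)) := by
  have hm' : 50 * (m : ℝ) ≤ n := by exact_mod_cast hm
  have hm1' : (1 : ℝ) ≤ m := by exact_mod_cast hm1
  have := abs_krawtchoukSeq_le_geometric (n := n) (z := z) (θ := 1.094) (B := 0.84 ^ (2 * m - 1))
    (a := 6 * m - 1) (b := i) hz (by positivity) (by norm_num) (by linarith)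
    (abs_krawtchoukSeq_le_of_six_mul hz hm hm1 hzn _ (by omega) (by omega))
    (by
      refine (abs_krawtchoukSeq_le_of_six_mul hz hm hm1 hzn _ (by omega) (by omega)).trans ?_
      exact le_mul_of_one_le_right (by positivity) (by norm_num))
    (by
      intro j hj
      have hj' : (j : ℝ) + 1 ≤ i := by exact_mod_cast hj.le
      linarith) (i - (6 * m - 1)) (by omega)
  rwa [show 6 * m - 1 + (i - (6 * m - 1)) = i by omega] at this

lemma exists_mul_mul_pow_le_one {c : ℝ} (hc0 : 0 ≤ c) (hc : c < 1) (L : ℝ) :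
    ∃ X : ℕ, ∀ x : ℕ, X ≤ x → L * (x * c ^ x) ≤ 1 := by
  have h := (tendsto_self_mul_const_pow_of_lt_one hc0 hc).const_mul L
  rw [mul_zero] at h
  exact Filter.eventually_atTop.1 (h.eventually (eventually_le_nhds zero_lt_one))

/-- No single ratio below 1 works up to degree 0.17n, so the envelope has three stages with cut
points near 0.04n and 0.12n: decay by 0.84, no growth, growth by at most 1.094. The initial decay
outweighs the final growth, leaving an exponentially small bound. -/
lemma exists_krawtchoukSeq_lower_linear (α : ℝ) (hα : 0 < α) (hα' : α ≤ 0.17) :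
    ∃ N : ℕ, ∀ n s : ℕ, (s : ℝ) = α * ((n : ℝ) / 2) → N ≤ n → ∀ z : ℝ, |z| ≤ n →
      -(1 / ((n : ℝ) - 1)) ≤ krawtchoukSeq n z (2 * s) := by
  obtain ⟨X₁, hX₁⟩ := exists_mul_mul_pow_le_one (c := 0.84) (by norm_num) (by norm_num) (1 / α)
  obtain ⟨X₂, hX₂⟩ := exists_mul_mul_pow_le_one (c := 0.84) (by norm_num) (by norm_num) 100
  obtain ⟨X₃, hX₃⟩ := exists_mul_mul_pow_le_one (c := 0.93) (by norm_num) (by norm_num)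
    (100 * (0.84⁻¹ * 1.094 ^ 11))
  obtain ⟨N₁, hN₁⟩ := exists_nat_ge ((X₁ : ℝ) / α)
  refine ⟨N₁ + 50 * X₂ + 50 * X₃ + 150, fun n s hs hn => ?_⟩
  have hn150 : (150 : ℝ) ≤ n := by
    have : 150 ≤ n := by omega
    exact_mod_cast this
  have hnpos : (0 : ℝ) < n := by linarith
  have hspos : (0 : ℝ) < s := by rw [hs]; positivity
  have hs1 : 1 ≤ s := by exact_mod_cast hspos
  have hd : 2 * (s : ℝ) = α * n := by rw [hs]; ring
  have hd' : 2 * (s : ℝ) ≤ 0.17 * n := by rw [hd]; gcongr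
  refine krawtchoukSeq_lower_of_oscillating (by linarith) hs1 (by linarith) ?_
  intro z hz _ hosc
  -- The oscillating range gives z² ≤ 4·0.17·0.83·n² = 0.5644n².
  have hzn : z ≤ 0.7513 * n := by
    refine (pow_le_pow_iff_left₀ hz (by positivity) two_ne_zero).1 ?_
    nlinarith [mul_nonneg (by linarith : (0 : ℝ) ≤ 0.17 * n - 2 * s)
      (by linarith : (0 : ℝ) ≤ 0.83 * n - 2 * s)]
  suffices h : |krawtchoukSeq n z (2 * s)| ≤ 1 / n by
    refine h.trans (one_div_le_one_div_of_le ?_ ?_) <;> linarith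
  set m := n / 50 with hmdef
  have hm : 50 * m ≤ n := Nat.mul_div_le n 50
  have hm2 : n ≤ 50 * m + 49 := by omega
  have hm3 : 3 ≤ m := by omega
  have hm2' : (n : ℝ) ≤ 50 * m + 49 := by exact_mod_cast hm2
  have hm3' : (3 : ℝ) ≤ m := by exact_mod_cast hm3
  rw [le_div_iff₀ hnpos, mul_comm]
  rcases le_total (2 * s) (2 * m) with h1 | h1
  -- For small α the degree αn never leaves the decaying stage; n is then traded for 2s/α, so the
  -- threshold depends on α.
  · have hb := abs_krawtchoukSeq_le_of_two_mul hz hm (by omega) hzn _ h1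
    have hX : X₁ ≤ 2 * s := by
      have h2 : (X₁ : ℝ) ≤ 2 * s := by
        rw [hd]
        have : (X₁ : ℝ) / α ≤ n := hN₁.trans (by exact_mod_cast (by omega : N₁ ≤ n))
        rw [div_le_iff₀ hα] at this
        linarith
      exact_mod_cast h2
    have := hX₁ _ hX
    push_cast at this
    rw [hd] at this
    calc (n : ℝ) * |krawtchoukSeq n z (2 * s)| ≤ n * 0.84 ^ (2 * s) := by gcongr
      _ = 1 / α * (α * n * 0.84 ^ (2 * s)) := by field_simp
      _ ≤ 1 := this
  rcases le_total (2 * s) (6 * m) with h2 | h2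
  · have hb := abs_krawtchoukSeq_le_of_six_mul hz hm (by omega) hzn _ (by omega) h2
    have := hX₂ (2 * m - 1) (by omega)
    refine le_trans ?_ this
    rw [← mul_assoc]
    gcongr
    have : n ≤ 100 * (2 * m - 1) := by omega
    exact_mod_cast this
  · have hb := abs_krawtchoukSeq_le_of_ge_six_mul hz hm (by omega) hzn _ h2 (by push_cast; exact hd')
    have := hX₃ m (by omega)
    refine le_trans ?_ this
    -- The growing stage lasts about 8.5m - 6m = 2.5m steps; 3m + 11 absorbs the rounding in m =
    -- n/50.
    have hexp : 2 * s - (6 * m - 1) ≤ 3 * m + 11 := by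
      have h3 : 2 * (s : ℝ) < ((9 * m + 9 : ℕ) : ℝ) := by push_cast; linarith
      have : 2 * s < 9 * m + 9 := by exact_mod_cast h3
      omega
    have hpow : (0.84 : ℝ) ^ (2 * m - 1) = 0.84⁻¹ * (0.84 ^ 2) ^ m := by
      rw [← pow_mul, eq_inv_mul_iff_mul_eq₀ (by norm_num), ← pow_succ']
      congr 1; omega
    calc (n : ℝ) * |krawtchoukSeq n z (2 * s)|
        ≤ (100 * m) * (0.84 ^ (2 * m - 1) * 1.094 ^ (2 * s - (6 * m - 1))) := by
          gcongr; linarith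
      _ ≤ (100 * m) * (0.84 ^ (2 * m - 1) * 1.094 ^ (3 * m + 11)) := by
          gcongr; norm_num
      _ = 100 * (0.84⁻¹ * 1.094 ^ 11) * (m * (0.84 ^ 2 * 1.094 ^ 3) ^ m) := by
          rw [hpow, pow_add, pow_mul (1.094 : ℝ) 3 m, mul_pow (0.84 ^ 2 : ℝ)]; ring
      -- 0.84²·1.094³ is about 0.924.
      _ ≤ 100 * (0.84⁻¹ * 1.094 ^ 11) * (m * 0.93 ^ m) := by
          gcongr; norm_num

/-! ### Exchangeable signs with constant sum -/

section Exchangeable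

variable {ι α : Type*} [DecidableEq ι]

lemma prod_insert_comp_swap (ε : α → ℝ) (x : ι → α) {L : Finset ι} {i j : ι} (hi : i ∉ L)
    (hj : j ∉ L) :
    ∏ l ∈ insert i L, ε ((x ∘ Equiv.swap i j) l) = ∏ l ∈ insert j L, ε (x l) := by
  rw [Finset.prod_insert hi, Finset.prod_insert hj]
  congr 1
  · simp
  · refine Finset.prod_congr rfl fun l hl => ?_
    rw [Function.comp_apply, Equiv.swap_apply_of_ne_of_ne]
    · rintro rfl; exact hi hl
    · rintro rfl; exact hj hl

lemma sum_comp_swap {M : Type*} [AddCommMonoid M] {Ω : Finset (ι → α)} {i j : ι}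
    (hΩ : ∀ x ∈ Ω, x ∘ Equiv.swap i j ∈ Ω) (f : (ι → α) → M) :
    ∑ x ∈ Ω, f (x ∘ Equiv.swap i j) = ∑ x ∈ Ω, f x := by
  have hinv : ∀ x : ι → α, (x ∘ Equiv.swap i j) ∘ Equiv.swap i j = x := by
    intro x; ext l; simp
  exact Finset.sum_nbij' (fun x => x ∘ Equiv.swap i j) (fun x => x ∘ Equiv.swap i j) hΩ hΩ
    (fun x _ => hinv x) (fun x _ => hinv x) (fun _ _ => rfl)

variable {Ω : Finset (ι → α)} {w : (ι → α) → ℝ} {ε : α → ℝ} {U : Finset ι} {c : ℝ}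

/-- Sums of products of exchangeable signs with constant total satisfy a three-term recurrence. -/
lemma exchangeable_recurrence (hε : ∀ a, ε a * ε a = 1)
    (hsum : ∀ x ∈ Ω, ∑ j ∈ U, ε (x j) = c)
    (hΩ : ∀ i ∈ U, ∀ j ∈ U, ∀ x ∈ Ω, x ∘ Equiv.swap i j ∈ Ω)
    (hw : ∀ i ∈ U, ∀ j ∈ U, ∀ x, w (x ∘ Equiv.swap i j) = w x)
    {L : Finset ι} (hL : L ⊆ U) {i : ι} (hi : i ∈ U) (hiL : i ∉ L) :
    ((U.card : ℝ) - L.card) * ∑ x ∈ Ω, w x * ∏ l ∈ insert i L, ε (x l) =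
      c * (∑ x ∈ Ω, w x * ∏ l ∈ L, ε (x l)) -
        ∑ j ∈ L, ∑ x ∈ Ω, w x * ∏ l ∈ L.erase j, ε (x l) := by
  -- By exchangeability every way of adding one index outside L gives the same sum. Multiplying by c
  -- = ∑ ε(x_j) then yields |U| - |L| equal terms, while each j in L cancels a factor because ε² =
  -- 1.
  have hswap : ∀ j ∈ U \ L, ∑ x ∈ Ω, w x * ∏ l ∈ insert j L, ε (x l) =
      ∑ x ∈ Ω, w x * ∏ l ∈ insert i L, ε (x l) := by
    intro j hj
    rw [Finset.mem_sdiff] at hj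
    rw [← sum_comp_swap (hΩ i hi j hj.1) (fun x => w x * ∏ l ∈ insert i L, ε (x l))]
    refine Finset.sum_congr rfl fun x _ => ?_
    rw [hw i hi j hj.1, prod_insert_comp_swap ε x hiL hj.2]
  have hout : ∑ j ∈ U \ L, ∑ x ∈ Ω, w x * ∏ l ∈ insert j L, ε (x l) =
      ((U.card : ℝ) - L.card) * ∑ x ∈ Ω, w x * ∏ l ∈ insert i L, ε (x l) := by
    rw [Finset.sum_congr rfl hswap, Finset.sum_const, Finset.card_sdiff_of_subset hL, nsmul_eq_mul,
      Nat.cast_sub (Finset.card_le_card hL)]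
  rw [← hout, eq_sub_iff_add_eq, Finset.sum_comm, Finset.sum_comm (s := L), ← Finset.sum_add_distrib,
    Finset.mul_sum]
  refine Finset.sum_congr rfl fun x hx => ?_
  rw [← hsum x hx, ← Finset.sum_sdiff hL, add_mul, Finset.sum_mul, Finset.sum_mul]
  congr 1
  · refine Finset.sum_congr rfl fun j hj => ?_
    rw [Finset.prod_insert (Finset.mem_sdiff.1 hj).2]; ring
  · refine Finset.sum_congr rfl fun j hj => ?_
    rw [← Finset.mul_prod_erase L _ hj]
    linear_combination (-(w x * ∏ l ∈ L.erase j, ε (x l))) * hε (x j)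

/-- The recurrence for these sums is that of `krawtchoukSeq`. The weight w lets other coordinates
carry their own signs, so disjoint blocks can be treated one after the other. -/
lemma exchangeable_sum_eq (hε : ∀ a, ε a * ε a = 1)
    (hsum : ∀ x ∈ Ω, ∑ j ∈ U, ε (x j) = c)
    (hΩ : ∀ i ∈ U, ∀ j ∈ U, ∀ x ∈ Ω, x ∘ Equiv.swap i j ∈ Ω)
    (hw : ∀ i ∈ U, ∀ j ∈ U, ∀ x, w (x ∘ Equiv.swap i j) = w x)
    {K : Finset ι} (hK : K ⊆ U) :
    ∑ x ∈ Ω, w x * ∏ l ∈ K, ε (x l) = (∑ x ∈ Ω, w x) * krawtchoukSeq U.card c K.card := by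
  obtain ⟨d, hd⟩ : ∃ d, K.card = d := ⟨_, rfl⟩
  rw [hd]
  induction d using Nat.twoStepInduction generalizing K with
  | zero =>
    rw [Finset.card_eq_zero] at hd
    simp [hd, krawtchoukSeq_zero]
  | one =>
    obtain ⟨i, rfl⟩ := Finset.card_eq_one.1 hd
    have hi : i ∈ U := hK (Finset.mem_singleton_self i)
    have h := exchangeable_recurrence hε hsum hΩ hw (Finset.empty_subset U) hi
      (Finset.notMem_empty i)
    simp only [Finset.card_empty, Nat.cast_zero, sub_zero, insert_empty_eq, Finset.prod_empty,
      mul_one, Finset.sum_empty] at h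
    have hU : (U.card : ℝ) ≠ 0 := by exact_mod_cast (Finset.card_pos.2 ⟨i, hi⟩).ne'
    rw [krawtchoukSeq_one, mul_div_assoc', eq_div_iff hU]
    linarith
  | more d ih0 ih1 =>
    obtain ⟨i, L, hiL, rfl, hL⟩ := Finset.card_eq_succ.1 hd
    have hi : i ∈ U := hK (Finset.mem_insert_self i L)
    have hLU : L ⊆ U := (Finset.subset_insert i L).trans hK
    have h := exchangeable_recurrence hε hsum hΩ hw hLU hi hiL
    rw [ih1 hLU hL, Finset.sum_congr rfl (fun j hj => ih0 ((Finset.erase_subset j L).trans hLU)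
      (by rw [Finset.card_erase_of_mem hj, hL]; rfl)), Finset.sum_const, hL, nsmul_eq_mul] at h
    have hcard : d + 2 ≤ U.card := hd ▸ Finset.card_le_card hK
    have hne : (U.card : ℝ) - (d + 1) ≠ 0 := by
      have : (d : ℝ) + 2 ≤ U.card := by exact_mod_cast hcard
      exact ne_of_gt (by linarith)
    rw [krawtchoukSeq_add_two, mul_div_assoc', eq_div_iff hne]
    push_cast at h
    linarith

end Exchangeable

/-! ### Vectors of a given type -/

section Types

variable {n : ℕ} {t : Fin 4 → ℕ}

open Classical in
/-- The vectors of type `t` in `ℤ_4^n` as a finset. -/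
noncomputable def typeFinset (n : ℕ) (t : Fin 4 → ℕ) : Finset (Fin n → ZMod 4) :=
  Finset.univ.filter (fun x => x ∈ vectorsOfType 4 n t)

lemma mem_typeFinset {x : Fin n → ZMod 4} : x ∈ typeFinset n t ↔ x ∈ vectorsOfType 4 n t := by
  simp [typeFinset]

lemma charSum_eq_sum_typeFinset (v : Fin n → ZMod 4) :
    charSum 4 n t v = ∑ x ∈ typeFinset n t, ZMod.stdAddChar (v ⬝ᵥ x) := rfl

lemma hammingWt_comp_equiv (k : ZMod 4) (x : Fin n → ZMod 4) (σ : Equiv.Perm (Fin n)) :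
    hammingWt k (x ∘ σ) = hammingWt k x := by
  unfold hammingWt
  exact Finset.card_equiv σ (by simp)

lemma comp_equiv_mem_typeFinset {x : Fin n → ZMod 4} (σ : Equiv.Perm (Fin n))
    (hx : x ∈ typeFinset n t) : x ∘ σ ∈ typeFinset n t := by
  rw [mem_typeFinset] at hx ⊢
  intro k
  rw [hammingWt_comp_equiv]
  exact hx k

lemma sum_comp_of_mem_typeFinset {M : Type*} [AddCommMonoid M] (f : ZMod 4 → M)
    {x : Fin n → ZMod 4} (hx : x ∈ typeFinset n t) :
    ∑ j, f (x j) = t 0 • f 0 + t 1 • f 1 + t 2 • f 2 + t 3 • f 3 := by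
  rw [mem_typeFinset] at hx
  have h : ∑ j, f (x j) = ∑ k : ZMod 4, hammingWt k x • f k := by
    rw [← Finset.sum_fiberwise (s := Finset.univ) (g := x)]
    refine Finset.sum_congr rfl fun k _ => ?_
    rw [hammingWt, ← Finset.sum_const]
    exact Finset.sum_congr rfl fun j hj => by rw [(Finset.mem_filter.1 hj).2]
  rw [h]
  have h4 : ∑ k : ZMod 4, hammingWt k x • f k = ∑ k : Fin 4, hammingWt ((k : ℕ) : ZMod 4) x •
      f ((k : ℕ) : ZMod 4) := by
    refine Finset.sum_congr rfl fun k _ => ?_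
    have : ((ZMod.val k : ℕ) : ZMod 4) = k := ZMod.natCast_zmod_val k
    conv_lhs => rw [← this]
    rfl
  rw [h4, Finset.sum_congr rfl (fun k _ => by rw [hx k]), Fin.sum_univ_four]
  rfl

end Types

/-! ### Eigenvalues of the Cayley graph as character sums -/

section Spectrum

open Matrix

variable {n : ℕ} {t : Fin 4 → ℕ}

lemma typeCayley_adj_iff (hneg : ∀ x ∈ vectorsOfType 4 n t, -x ∈ vectorsOfType 4 n t)
    (h0 : (0 : Fin n → ZMod 4) ∉ vectorsOfType 4 n t) (x y : Fin n → ZMod 4) :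
    (typeCayley 4 n t).Adj x y ↔ y - x ∈ vectorsOfType 4 n t := by
  rw [typeCayley, SimpleGraph.addCayley_adj']
  constructor
  · rintro ⟨-, g, hg, rfl | rfl⟩
    · simpa using hg
    · simpa using hneg g hg
  · intro h
    refine ⟨?_, _, h, Or.inl (by abel)⟩
    rintro rfl
    exact h0 (by simpa using h)

open Classical in
lemma typeCayley_adjMatrix_mulVec
    (hneg : ∀ x ∈ vectorsOfType 4 n t, -x ∈ vectorsOfType 4 n t)
    (h0 : (0 : Fin n → ZMod 4) ∉ vectorsOfType 4 n t) (f : (Fin n → ZMod 4) → ℝ)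
    (x : Fin n → ZMod 4) :
    ((typeCayley 4 n t).adjMatrix ℝ *ᵥ f) x = ∑ g ∈ typeFinset n t, f (x + g) := by
  rw [SimpleGraph.adjMatrix_mulVec_apply]
  refine Finset.sum_nbij' (fun y => y - x) (fun g => x + g) ?_ ?_ ?_ ?_ ?_
  · intro y hy
    rw [SimpleGraph.mem_neighborFinset, typeCayley_adj_iff hneg h0] at hy
    exact mem_typeFinset.2 hy
  · intro g hg
    rw [SimpleGraph.mem_neighborFinset, typeCayley_adj_iff hneg h0]
    simpa using mem_typeFinset.1 hg
  · intro y _; abel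
  · intro g _; abel
  · intro y _; congr 1; abel

lemma sum_stdAddChar_dotProduct_of_ne_zero {u : Fin n → ZMod 4} (hu : u ≠ 0) :
    ∑ v : Fin n → ZMod 4, ZMod.stdAddChar (v ⬝ᵥ u) = 0 := by
  obtain ⟨i, hi⟩ := Function.ne_iff.1 hu
  have h1 : ZMod.stdAddChar (u i) ≠ 1 := by
    intro h
    rw [← AddChar.map_zero_eq_one (ZMod.stdAddChar (N := 4))] at h
    exact hi (ZMod.injective_stdAddChar h)
  -- Shifting v by the i-th basis vector permutes the summation range and multiplies the sum by a
  -- factor other than 1.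
  have h2 : ∑ v : Fin n → ZMod 4, ZMod.stdAddChar (v ⬝ᵥ u) =
      ZMod.stdAddChar (u i) * ∑ v : Fin n → ZMod 4, ZMod.stdAddChar (v ⬝ᵥ u) := by
    rw [Finset.mul_sum, ← Equiv.sum_comp (Equiv.addLeft (Pi.single i (1 : ZMod 4)))]
    refine Finset.sum_congr rfl fun v _ => ?_
    rw [Equiv.coe_addLeft, add_dotProduct, single_dotProduct, one_mul, AddChar.map_add_eq_mul]
  have h3 : (1 - ZMod.stdAddChar (u i)) * ∑ v : Fin n → ZMod 4, ZMod.stdAddChar (v ⬝ᵥ u) = 0 := by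
    linear_combination h2
  exact (mul_eq_zero.1 h3).resolve_left (sub_ne_zero.2 h1.symm)

/-- A function on `ℤ_4^n` with vanishing Fourier transform is zero. -/
lemma eq_zero_of_fourier_eq_zero {f : (Fin n → ZMod 4) → ℂ}
    (h : ∀ v : Fin n → ZMod 4, ∑ x, f x * ZMod.stdAddChar (v ⬝ᵥ x) = 0) : f = 0 := by
  ext y
  have h1 : ∑ v : Fin n → ZMod 4, (∑ x, f x * ZMod.stdAddChar (v ⬝ᵥ x)) *
      ZMod.stdAddChar (-(v ⬝ᵥ y)) = f y * (Fintype.card (Fin n → ZMod 4) : ℂ) := by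
    simp_rw [Finset.sum_mul]
    rw [Finset.sum_comm, Finset.sum_eq_single y]
    · simp_rw [mul_assoc, ← AddChar.map_add_eq_mul]
      simp
      ring
    · intro x _ hxy
      simp_rw [mul_assoc, ← AddChar.map_add_eq_mul, ← sub_eq_add_neg, ← dotProduct_sub]
      rw [← Finset.mul_sum, sum_stdAddChar_dotProduct_of_ne_zero (sub_ne_zero.2 hxy), mul_zero]
    · simp
  simp only [h, zero_mul, Finset.sum_const_zero] at h1
  exact (mul_eq_zero.1 h1.symm).resolve_right (by simp)

/-- The Fourier transform turns adjacency into multiplication by λ(-v). If μ differed from every λ,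
the transform of an eigenvector would vanish identically, and so would the eigenvector. -/
lemma exists_charSum_eq_of_mem_graphEigenvalues
    (hneg : ∀ x ∈ vectorsOfType 4 n t, -x ∈ vectorsOfType 4 n t)
    (h0 : (0 : Fin n → ZMod 4) ∉ vectorsOfType 4 n t) {μ : ℝ}
    (hμ : μ ∈ graphEigenvalues (typeCayley 4 n t)) : ∃ v, charSum 4 n t v = (μ : ℂ) := by
  classical
  obtain ⟨f, hf⟩ := Module.End.HasEigenvalue.exists_hasEigenvector hμ
  have hfx : ∀ x, ∑ g ∈ typeFinset n t, f (x + g) = μ * f x := by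
    intro x
    have := congrFun hf.apply_eq_smul x
    rw [Matrix.mulVecLin_apply] at this
    rw [← typeCayley_adjMatrix_mulVec hneg h0]
    convert this using 1
    simp
  by_contra! hne
  apply hf.2
  have hz : (fun x => (f x : ℂ)) = 0 := by
    refine eq_zero_of_fourier_eq_zero fun v => ?_
    have h1 : (μ : ℂ) * ∑ x, (f x : ℂ) * ZMod.stdAddChar (v ⬝ᵥ x) =
        charSum 4 n t (-v) * ∑ x, (f x : ℂ) * ZMod.stdAddChar (v ⬝ᵥ x) := by
      calc (μ : ℂ) * ∑ x, (f x : ℂ) * ZMod.stdAddChar (v ⬝ᵥ x)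
          = ∑ x, ((∑ g ∈ typeFinset n t, f (x + g) : ℝ) : ℂ) * ZMod.stdAddChar (v ⬝ᵥ x) := by
            rw [Finset.mul_sum]
            refine Finset.sum_congr rfl fun x _ => ?_
            rw [hfx]; push_cast; ring
        _ = ∑ g ∈ typeFinset n t, ∑ x, (f (x + g) : ℂ) * ZMod.stdAddChar (v ⬝ᵥ x) := by
            rw [Finset.sum_comm]
            refine Finset.sum_congr rfl fun x _ => ?_
            push_cast
            rw [Finset.sum_mul]
        _ = ∑ g ∈ typeFinset n t, ZMod.stdAddChar (-v ⬝ᵥ g) *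
              ∑ x, (f x : ℂ) * ZMod.stdAddChar (v ⬝ᵥ x) := by
            refine Finset.sum_congr rfl fun g _ => ?_
            rw [Finset.mul_sum, ← Equiv.sum_comp (Equiv.addRight g)
              (fun x => ZMod.stdAddChar (-v ⬝ᵥ g) * ((f x : ℂ) * ZMod.stdAddChar (v ⬝ᵥ x)))]
            refine Finset.sum_congr rfl fun x _ => ?_
            rw [Equiv.coe_addRight, mul_left_comm, ← AddChar.map_add_eq_mul]
            congr 2
            rw [dotProduct_add, neg_dotProduct]; abel
        _ = _ := by rw [← Finset.sum_mul, charSum_eq_sum_typeFinset]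
    have h2 : (charSum 4 n t (-v) - μ) * ∑ x, (f x : ℂ) * ZMod.stdAddChar (v ⬝ᵥ x) = 0 := by
      linear_combination -h1
    exact (mul_eq_zero.1 h2).resolve_left (sub_ne_zero.2 (hne (-v)))
  ext x
  have := congrFun hz x
  simpa using this

lemma mem_graphEigenvalues_of_charSum_eq
    (hneg : ∀ x ∈ vectorsOfType 4 n t, -x ∈ vectorsOfType 4 n t)
    (h0 : (0 : Fin n → ZMod 4) ∉ vectorsOfType 4 n t) {μ : ℝ} {v : Fin n → ZMod 4}
    (hv : charSum 4 n t v = (μ : ℂ)) : μ ∈ graphEigenvalues (typeCayley 4 n t) := by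
  classical
  -- The matrix and λ(v) are real, so the real part of the character is an eigenfunction; it is
  -- nonzero because its value at 0 is 1.
  refine Module.End.hasEigenvalue_of_hasEigenvector
    (x := fun x => (ZMod.stdAddChar (v ⬝ᵥ x) : ℂ).re) ⟨Module.End.mem_eigenspace_iff.2 ?_, ?_⟩
  · ext x
    have h := typeCayley_adjMatrix_mulVec hneg h0 (fun x => (ZMod.stdAddChar (v ⬝ᵥ x) : ℂ).re) x
    rw [Matrix.mulVecLin_apply]
    convert h using 1
    rw [Pi.smul_apply, smul_eq_mul, ← Complex.re_ofReal_mul, ← hv, charSum_eq_sum_typeFinset,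
      Finset.sum_mul, Complex.re_sum]
    refine Finset.sum_congr rfl fun g _ => ?_
    rw [← AddChar.map_add_eq_mul, ← dotProduct_add, add_comm]
  · intro h
    have := congrFun h 0
    simp at this

end Spectrum

/-! ### Size of the generating set -/

section Count

variable {n : ℕ} {t : Fin 4 → ℕ}

lemma sum_single_apply_eq_hammingWt (x : Fin n → ZMod 4) (k : ZMod 4) :
    (∑ j, Finsupp.single (x j) 1 : ZMod 4 →₀ ℕ) k = hammingWt k x := by
  rw [Finsupp.finsetSum_apply, hammingWt, Finset.card_filter]
  exact Finset.sum_congr rfl fun j _ => Finsupp.single_apply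

/-- The number of vectors of a given type is a multinomial coefficient. -/
lemma card_typeFinset (ht : t 0 + t 1 + t 2 + t 3 = n) :
    (typeFinset n t).card = Nat.multinomial Finset.univ t := by
  classical
  set d : ZMod 4 →₀ ℕ := Finsupp.equivFunOnFinite.symm (show ZMod 4 → ℕ from t) with hd
  have hdk : ∀ k : Fin 4, d ((k : ℕ) : ZMod 4) = t k := by
    intro k
    fin_cases k <;> rfl
  -- One coefficient of (∑ X_i)^n is computed twice: by the multinomial theorem, and by expanding
  -- the power over words x.
  have h1 := MvPolynomial.coeff_sum_X_pow_of_fintype (R := ℕ) d n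
  have hsum : d.sum (fun _ m => m) = n := by
    rw [Finsupp.sum_fintype _ _ (fun _ => rfl), ← ht]
    exact Fin.sum_univ_four t
  rw [if_pos hsum, Finsupp.multinomial_eq_of_support_subset (Finset.subset_univ _)] at h1
  have h2 : ((∑ i, MvPolynomial.X i : MvPolynomial (ZMod 4) ℕ)) ^ n =
      ∑ x : Fin n → ZMod 4, MvPolynomial.monomial (∑ j, Finsupp.single (x j) 1) 1 := by
    have := Finset.prod_univ_sum (ι := Fin n) (fun _ => (Finset.univ : Finset (ZMod 4)))
      (fun _ i => (MvPolynomial.X i : MvPolynomial (ZMod 4) ℕ))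
    rw [Finset.prod_const, Finset.card_univ, Fintype.card_fin, Fintype.piFinset_univ] at this
    rw [this]
    refine Finset.sum_congr rfl fun x _ => ?_
    rw [MvPolynomial.monomial_sum_one]
    rfl
  rw [h2, MvPolynomial.coeff_sum] at h1
  simp only [MvPolynomial.coeff_monomial] at h1
  rw [← Finset.card_filter] at h1
  have h3 : typeFinset n t = Finset.univ.filter
      (fun x : Fin n → ZMod 4 => (∑ j, Finsupp.single (x j) 1 : ZMod 4 →₀ ℕ) = d) := by
    ext x
    rw [mem_typeFinset, Finset.mem_filter, vectorsOfType, Set.mem_ofPred_eq]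
    constructor
    · intro h
      refine ⟨Finset.mem_univ _, Finsupp.ext fun k => ?_⟩
      rw [sum_single_apply_eq_hammingWt]
      have hk := (h k).trans (hdk k).symm
      have hkk : (((show Fin 4 from k : ℕ)) : ZMod 4) = k := ZMod.natCast_zmod_val k
      rwa [hkk] at hk
    · rintro ⟨-, h⟩ k
      rw [← hdk, ← h, sum_single_apply_eq_hammingWt]
  rw [h3]
  exact h1

end Count

/-! ### Factorizations of the character of order 4 -/

section Character

lemma stdAddChar_four_one : ZMod.stdAddChar (1 : ZMod 4) = Complex.I := by
  have h := ZMod.stdAddChar_coe (N := 4) 1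
  rw [Int.cast_one] at h
  refine h.trans (Eq.trans ?_ Complex.exp_pi_div_two_mul_I)
  rw [Int.cast_one, Nat.cast_ofNat]
  ring_nf

lemma stdAddChar_four_two : ZMod.stdAddChar (2 : ZMod 4) = -1 := by
  rw [show (2 : ZMod 4) = 1 + 1 by rfl, AddChar.map_add_eq_mul, stdAddChar_four_one,
    Complex.I_mul_I]

lemma stdAddChar_four_three : ZMod.stdAddChar (3 : ZMod 4) = -Complex.I := by
  rw [show (3 : ZMod 4) = 2 + 1 by rfl, AddChar.map_add_eq_mul, stdAddChar_four_one,
    stdAddChar_four_two, neg_one_mul]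

lemma zmod_four_cases (a : ZMod 4) : a = 0 ∨ a = 1 ∨ a = 2 ∨ a = 3 := by
  revert a; decide

/-- The sign of the upper binary digit. -/
def upperSign (a : ZMod 4) : ℝ := if a = 0 ∨ a = 1 then 1 else -1

/-- The sign of the lower binary digit. -/
def paritySign (a : ZMod 4) : ℝ := if a = 1 ∨ a = 3 then -1 else 1

/-- The sign marking the residue `2`. -/
def twoSign (a : ZMod 4) : ℝ := if a = 2 then -1 else 1

lemma upperSign_mul_self (a : ZMod 4) : upperSign a * upperSign a = 1 := by
  unfold upperSign; split_ifs <;> norm_num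

lemma paritySign_mul_self (a : ZMod 4) : paritySign a * paritySign a = 1 := by
  unfold paritySign; split_ifs <;> norm_num

lemma twoSign_mul_self (a : ZMod 4) : twoSign a * twoSign a = 1 := by
  unfold twoSign; split_ifs <;> norm_num

lemma upperSign_zero : upperSign 0 = 1 := if_pos (by decide)
lemma upperSign_one : upperSign 1 = 1 := if_pos (by decide)
lemma upperSign_two : upperSign 2 = -1 := if_neg (by decide)
lemma upperSign_three : upperSign 3 = -1 := if_neg (by decide)
lemma paritySign_zero : paritySign 0 = 1 := if_neg (by decide)
lemma paritySign_one : paritySign 1 = -1 := if_pos (by decide)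
lemma paritySign_two : paritySign 2 = 1 := if_neg (by decide)
lemma paritySign_three : paritySign 3 = -1 := if_pos (by decide)
lemma twoSign_zero : twoSign 0 = 1 := if_neg (by decide)
lemma twoSign_one : twoSign 1 = 1 := if_neg (by decide)
lemma twoSign_two : twoSign 2 = -1 := if_pos rfl
lemma twoSign_three : twoSign 3 = 1 := if_neg (by decide)

/-- Splitting the character into a unimodular factor that sees only the parity of `x` and a sign. -/
lemma stdAddChar_mul_eq (v x : ZMod 4) :
    ZMod.stdAddChar (v * x) = ZMod.stdAddChar (v * if x = 1 ∨ x = 3 then 1 else 0) *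
      ((if v = 1 ∨ v = 3 then upperSign x else 1 : ℝ) : ℂ) := by
  have h22 : (2 : ZMod 4) * 2 = 0 := rfl
  have h23 : (2 : ZMod 4) * 3 = 2 := rfl
  have h32 : (3 : ZMod 4) * 2 = 2 := rfl
  have h33 : (3 : ZMod 4) * 3 = 1 := rfl
  have n1 : ¬ ((0 : ZMod 4) = 1 ∨ (0 : ZMod 4) = 3) := by decide
  have n2 : ¬ ((2 : ZMod 4) = 1 ∨ (2 : ZMod 4) = 3) := by decide
  rcases zmod_four_cases v with rfl | rfl | rfl | rfl <;>
    rcases zmod_four_cases x with rfl | rfl | rfl | rfl <;>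
    simp only [if_neg n1, if_neg n2, h22, h23, h32, h33, mul_zero, zero_mul,
      mul_one, one_mul, stdAddChar_four_one, stdAddChar_four_two, stdAddChar_four_three,
      AddChar.map_zero_eq_one, upperSign_zero, upperSign_one, upperSign_two, upperSign_three] <;>
    simp [stdAddChar_four_one, stdAddChar_four_two, stdAddChar_four_three]

lemma stdAddChar_mul_eq_paritySign (v x : ZMod 4) (hv : v = 0 ∨ v = 2) :
    ZMod.stdAddChar (v * x) = ((if v = 2 then paritySign x else 1 : ℝ) : ℂ) := by
  have h22 : (2 : ZMod 4) * 2 = 0 := rfl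
  have h23 : (2 : ZMod 4) * 3 = 2 := rfl
  have n1 : ¬ ((0 : ZMod 4) = 2) := by decide
  rcases hv with rfl | rfl <;>
    rcases zmod_four_cases x with rfl | rfl | rfl | rfl <;>
    simp only [if_neg n1, if_pos, h22, h23, mul_zero, zero_mul,
      mul_one, stdAddChar_four_two,
      AddChar.map_zero_eq_one, paritySign_zero, paritySign_one, paritySign_two,
      paritySign_three] <;>
    simp

lemma stdAddChar_mul_eq_twoSign (v x : ZMod 4) (hv : v = 0 ∨ v = 2) :
    ZMod.stdAddChar (v * x) = ((if x = 1 ∨ x = 3 then twoSign v else 1 : ℝ) : ℂ) := by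
  rw [stdAddChar_mul_eq_paritySign v x hv, paritySign, twoSign]
  split_ifs <;> rfl

variable {n : ℕ}

lemma stdAddChar_dotProduct (v x : Fin n → ZMod 4) :
    ZMod.stdAddChar (v ⬝ᵥ x) = ∏ j, ZMod.stdAddChar (v j * x j) := by
  rw [dotProduct]
  exact map_prod ZMod.stdAddChar.toMonoidHom (fun j => Multiplicative.ofAdd (v j * x j)) Finset.univ

/-- The set of coordinates with an odd entry. -/
def oddSet (x : Fin n → ZMod 4) : Finset (Fin n) :=
  Finset.univ.filter fun j => x j = 1 ∨ x j = 3

lemma mem_oddSet {x : Fin n → ZMod 4} {j : Fin n} : j ∈ oddSet x ↔ x j = 1 ∨ x j = 3 := by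
  simp [oddSet]

lemma stdAddChar_dotProduct_eq (v x : Fin n → ZMod 4) :
    ZMod.stdAddChar (v ⬝ᵥ x) =
      ZMod.stdAddChar (v ⬝ᵥ fun j => if j ∈ oddSet x then 1 else 0) *
        ((∏ j ∈ oddSet v, upperSign (x j) : ℝ) : ℂ) := by
  rw [stdAddChar_dotProduct, stdAddChar_dotProduct, oddSet, oddSet, Finset.prod_filter,
    Complex.ofReal_prod, ← Finset.prod_mul_distrib]
  refine Finset.prod_congr rfl fun j _ => ?_
  rw [stdAddChar_mul_eq]
  simp

lemma stdAddChar_dotProduct_eq_paritySign {v : Fin n → ZMod 4} (hv : ∀ j, v j = 0 ∨ v j = 2)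
    (x : Fin n → ZMod 4) :
    ZMod.stdAddChar (v ⬝ᵥ x) =
      ((∏ j ∈ Finset.univ.filter (fun j => v j = 2), paritySign (x j) : ℝ) : ℂ) := by
  rw [stdAddChar_dotProduct, Finset.prod_filter, Complex.ofReal_prod]
  exact Finset.prod_congr rfl fun j _ => stdAddChar_mul_eq_paritySign _ _ (hv j)

lemma stdAddChar_dotProduct_eq_twoSign {v : Fin n → ZMod 4} (hv : ∀ j, v j = 0 ∨ v j = 2)
    (x : Fin n → ZMod 4) :
    ZMod.stdAddChar (v ⬝ᵥ x) = ((∏ j ∈ oddSet x, twoSign (v j) : ℝ) : ℂ) := by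
  rw [stdAddChar_dotProduct, oddSet, Finset.prod_filter, Complex.ofReal_prod]
  exact Finset.prod_congr rfl fun j _ => stdAddChar_mul_eq_twoSign _ _ (hv j)

lemma norm_stdAddChar (a : ZMod 4) : ‖(ZMod.stdAddChar a : ℂ)‖ = 1 := by
  rw [ZMod.stdAddChar_apply]; exact Circle.norm_coe _

end Character

/-! ### Symmetries and bounds for the type (r,s,r,s) -/

section BalancedType

open Matrix

variable {n r s : ℕ}

lemma neg_mem_vectorsOfType {x : Fin n → ZMod 4} (hx : x ∈ vectorsOfType 4 n ![r, s, r, s]) :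
    -x ∈ vectorsOfType 4 n ![r, s, r, s] := by
  have hneg : ∀ k : ZMod 4, hammingWt k (-x) = hammingWt (-k) x := by
    intro k
    unfold hammingWt
    congr 1
    ext j
    simp [neg_eq_iff_eq_neg]
  intro k
  rw [hneg]
  fin_cases k
  · exact hx 0
  · exact hx 3
  · exact hx 2
  · exact hx 1

lemma zero_notMem_vectorsOfType (hs : 1 ≤ s) :
    (0 : Fin n → ZMod 4) ∉ vectorsOfType 4 n ![r, s, r, s] := by
  intro h
  have h1 : hammingWt (1 : ZMod 4) (0 : Fin n → ZMod 4) = s := h 1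
  have h2 : hammingWt (1 : ZMod 4) (0 : Fin n → ZMod 4) = 0 := by
    unfold hammingWt
    rw [Finset.card_eq_zero, Finset.filter_eq_empty_iff]
    intro j _
    change ¬ ((0 : ZMod 4) = 1)
    decide
  omega

lemma sum_comp_of_mem_balanced {M : Type*} [AddCommMonoid M] (f : ZMod 4 → M)
    {x : Fin n → ZMod 4} (hx : x ∈ typeFinset n ![r, s, r, s]) :
    ∑ j, f (x j) = r • f 0 + s • f 1 + r • f 2 + s • f 3 :=
  sum_comp_of_mem_typeFinset f hx

/-- The sum is s + 2r + 3s = 2r + 4s, which vanishes mod 4 exactly because r is even. -/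
lemma sum_coord_eq_zero (hr : Even r) {x : Fin n → ZMod 4}
    (hx : x ∈ typeFinset n ![r, s, r, s]) : ∑ j, x j = 0 := by
  rw [sum_comp_of_mem_balanced (fun a => a) hx]
  obtain ⟨k, rfl⟩ := hr
  simp only [nsmul_eq_mul]
  push_cast
  have h4 : (4 : ZMod 4) = 0 := rfl
  linear_combination ((k : ZMod 4) + s) * h4

/-- Translating by a constant vector does not change the character sum. -/
lemma charSum_add_const (hr : Even r) (v : Fin n → ZMod 4) (c : ZMod 4) :
    charSum 4 n ![r, s, r, s] (v + fun _ => c) = charSum 4 n ![r, s, r, s] v := by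
  rw [charSum_eq_sum_typeFinset, charSum_eq_sum_typeFinset]
  refine Finset.sum_congr rfl fun x hx => ?_
  have : (fun _ => c) ⬝ᵥ x = 0 := by
    rw [dotProduct, ← Finset.mul_sum, sum_coord_eq_zero hr hx, mul_zero]
  rw [add_dotProduct, this, add_zero]

/-- The character sum at a difference of two basis vectors. -/
lemma charSum_single_sub_single {a b : Fin n} (hab : a ≠ b) :
    charSum 4 n ![r, s, r, s] (Pi.single a 1 - Pi.single b 1) =
      ((-((typeFinset n ![r, s, r, s]).card : ℝ) / ((n : ℝ) - 1) : ℝ) : ℂ) := by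
  set S := typeFinset n ![r, s, r, s] with hS
  have hdot : ∀ b' : Fin n, ∀ x : Fin n → ZMod 4,
      (Pi.single a 1 - Pi.single b' 1) ⬝ᵥ x = x a - x b' := by
    intro b' x
    simp [sub_dotProduct]
  -- Swapping b with b' shows that all n-1 choices of second index give the same sum; `htot`
  -- evaluates their total, since ∑ i^(x_a - x_b') over all b' is zero and the term b' = a equals 1.
  have hsame : ∀ b' ∈ Finset.univ.erase a,
      ∑ x ∈ S, (ZMod.stdAddChar (x a - x b') : ℂ) = ∑ x ∈ S, ZMod.stdAddChar (x a - x b) := by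
    intro b' hb'
    have hb' := Finset.ne_of_mem_erase hb'
    rw [← sum_comp_swap (i := b) (j := b') (fun x hx => comp_equiv_mem_typeFinset _ hx)
      (fun x => (ZMod.stdAddChar (x a - x b) : ℂ))]
    refine Finset.sum_congr rfl fun x _ => ?_
    simp [Equiv.swap_apply_of_ne_of_ne hab hb'.symm]
  have htot : ∑ b' ∈ Finset.univ.erase a, ∑ x ∈ S, (ZMod.stdAddChar (x a - x b') : ℂ) =
      -(S.card : ℂ) := by
    rw [Finset.sum_comm]
    have : ∀ x ∈ S, ∑ b' ∈ Finset.univ.erase a, (ZMod.stdAddChar (x a - x b') : ℂ) = -1 := by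
      intro x hx
      have h1 : ∑ b', (ZMod.stdAddChar (x a - x b') : ℂ) = 0 := by
        have := sum_comp_of_mem_balanced (fun y => (ZMod.stdAddChar (-y) : ℂ)) hx
        simp_rw [sub_eq_add_neg, AddChar.map_add_eq_mul]
        rw [← Finset.mul_sum, this, show (-1 : ZMod 4) = 3 by rfl, show (-2 : ZMod 4) = 2 by rfl,
          show (-3 : ZMod 4) = 1 by rfl, neg_zero, AddChar.map_zero_eq_one, stdAddChar_four_one,
          stdAddChar_four_two, stdAddChar_four_three]
        simp
      rw [← Finset.add_sum_erase _ _ (Finset.mem_univ a), sub_self, AddChar.map_zero_eq_one] at h1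
      linear_combination h1
    rw [Finset.sum_congr rfl this]
    simp
  rw [Finset.sum_congr rfl hsame, Finset.sum_const, Finset.card_erase_of_mem (Finset.mem_univ a),
    Finset.card_univ, Fintype.card_fin, nsmul_eq_mul] at htot
  have hn : 2 ≤ n := by
    by_contra h
    exact hab (Fin.ext (by have := a.2; have := b.2; omega))
  rw [Nat.cast_sub (by omega), Nat.cast_one] at htot
  have hne : (n : ℂ) - 1 ≠ 0 := by
    have : (n : ℂ) ≠ 1 := by
      norm_cast; omega
    exact sub_ne_zero.2 this
  rw [charSum_eq_sum_typeFinset]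
  simp_rw [hdot]
  push_cast
  rw [eq_div_iff hne]
  linear_combination htot

lemma oddSet_comp_swap {x : Fin n → ZMod 4} {D : Finset (Fin n)} (hx : oddSet x = D)
    {i j : Fin n} (hij : i ∈ D ↔ j ∈ D) : oddSet (x ∘ Equiv.swap i j) = D := by
  subst hx
  ext l
  rw [mem_oddSet, Function.comp_apply, ← mem_oddSet]
  by_cases hi : l = i
  · subst hi; simpa using hij.symm
  by_cases hj : l = j
  · subst hj; simpa using hij
  rw [Equiv.swap_apply_of_ne_of_ne hi hj]

lemma krawtchoukSeq_zero_mul_sign {p q : ℝ} {a c m : ℕ} (ha : (a : ℝ) ≤ p) (hc : (c : ℝ) ≤ q)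
    (hm : a + c = 2 * m) :
    0 ≤ (-1) ^ m * (krawtchoukSeq p 0 a * krawtchoukSeq q 0 c) := by
  rcases Nat.even_or_odd' a with ⟨a', rfl | rfl⟩
  · obtain ⟨c', rfl⟩ : ∃ c', c = 2 * c' := ⟨m - a', by omega⟩
    obtain rfl : m = a' + c' := by omega
    push_cast at ha hc
    have := mul_nonneg (krawtchoukSeq_zero_even_sign p a' ha) (krawtchoukSeq_zero_even_sign q c' hc)
    refine this.trans_eq ?_
    rw [pow_add]; ring
  · simp [krawtchoukSeq_zero_odd]

/-- A nonzero product has both indices even, and its sign (-1)^m depends on a + c but not on how the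
total is split. This excludes cancellation between parity classes. -/
lemma krawtchoukSeq_zero_mul_of_odd (p q : ℝ) {a c : ℕ} (h : Odd (a + c)) :
    krawtchoukSeq p 0 a * krawtchoukSeq q 0 c = 0 := by
  rcases Nat.even_or_odd' a with ⟨a', rfl | rfl⟩
  · obtain ⟨m, hm⟩ := h
    obtain rfl : c = 2 * (m - a') + 1 := by omega
    rw [krawtchoukSeq_zero_odd, mul_zero]
  · rw [krawtchoukSeq_zero_odd, zero_mul]

/-- The sum over the vectors with a prescribed odd set factors through both parts. -/
lemma sum_upperSign_fiber (D K : Finset (Fin n)) :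
    ∑ x ∈ (typeFinset n ![r, s, r, s]).filter (fun x => oddSet x = D),
        ∏ j ∈ K, upperSign (x j) =
      (((typeFinset n ![r, s, r, s]).filter (fun x => oddSet x = D)).card : ℝ) *
        (krawtchoukSeq Dᶜ.card 0 (K \ D).card * krawtchoukSeq D.card 0 (K ∩ D).card) := by
  set Ω := (typeFinset n ![r, s, r, s]).filter (fun x => oddSet x = D) with hΩ
  have hswap : ∀ i j : Fin n, (i ∈ D ↔ j ∈ D) → ∀ x ∈ Ω, x ∘ Equiv.swap i j ∈ Ω := by
    intro i j hij x hx
    rw [hΩ, Finset.mem_filter] at hx ⊢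
    exact ⟨comp_equiv_mem_typeFinset _ hx.1, oddSet_comp_swap hx.2 hij⟩
  have n0 : ¬ ((0 : ZMod 4) = 1 ∨ (0 : ZMod 4) = 3) := by decide
  have n2 : ¬ ((2 : ZMod 4) = 1 ∨ (2 : ZMod 4) = 3) := by decide
  have hsumD : ∀ x ∈ Ω, ∑ j ∈ D, upperSign (x j) = 0 := by
    intro x hx
    rw [hΩ, Finset.mem_filter] at hx
    rw [← hx.2, oddSet, Finset.sum_filter,
      sum_comp_of_mem_balanced (fun a => if a = 1 ∨ a = 3 then upperSign a else 0) hx.1]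
    simp only [if_neg n0, if_neg n2, upperSign_one, upperSign_three]
    simp
  have hsumC : ∀ x ∈ Ω, ∑ j ∈ Dᶜ, upperSign (x j) = 0 := by
    intro x hx
    have hD := hsumD x hx
    rw [hΩ, Finset.mem_filter] at hx
    have h := Finset.sum_add_sum_compl D (fun j => upperSign (x j))
    rw [hD, sum_comp_of_mem_balanced upperSign hx.1, upperSign_zero, upperSign_one, upperSign_two,
      upperSign_three] at h
    rw [zero_add] at h
    rw [h]
    simp
  -- First the signs inside D are averaged, those outside serving as the invariant weight; then `h2`
  -- averages the weight over the complement.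
  have h1 := exchangeable_sum_eq (Ω := Ω) (w := fun x => ∏ j ∈ K \ D, upperSign (x j))
    upperSign_mul_self hsumD (fun i hi j hj => hswap i j (by simp [hi, hj]))
    (by
      intro i hi j hj x
      refine Finset.prod_congr rfl fun l hl => ?_
      rw [Finset.mem_sdiff] at hl
      rw [Function.comp_apply, Equiv.swap_apply_of_ne_of_ne]
      · rintro rfl; exact hl.2 hi
      · rintro rfl; exact hl.2 hj) (Finset.inter_subset_right (s₁ := K) (s₂ := D))
  have h2 := exchangeable_sum_eq (Ω := Ω) (w := fun _ => 1) (U := Dᶜ) (K := K \ D)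
    upperSign_mul_self hsumC
    (fun i hi j hj => hswap i j (by
      rw [Finset.mem_compl] at hi hj; simp [hi, hj]))
    (fun _ _ _ _ _ => rfl)
    (fun l hl => Finset.mem_compl.2 (Finset.mem_sdiff.1 hl).2)
  simp only [one_mul, Finset.sum_const, nsmul_eq_mul, mul_one] at h2
  rw [h2] at h1
  rw [← mul_assoc, ← h1]
  refine Finset.sum_congr rfl fun x _ => ?_
  rw [mul_comm, Finset.prod_inter_mul_prod_sdiff]

lemma sum_upperSign (K : Finset (Fin n)) :
    ∑ x ∈ typeFinset n ![r, s, r, s], ∏ j ∈ K, upperSign (x j) =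
      ((typeFinset n ![r, s, r, s]).card : ℝ) * krawtchoukSeq n 0 K.card := by
  have h := exchangeable_sum_eq (Ω := typeFinset n ![r, s, r, s]) (w := fun _ => 1)
    (U := Finset.univ) (c := 0) (K := K) upperSign_mul_self
    (by
      intro x hx
      rw [sum_comp_of_mem_balanced upperSign hx, upperSign_zero, upperSign_one, upperSign_two,
        upperSign_three]
      simp)
    (fun i _ j _ x hx => comp_equiv_mem_typeFinset _ hx) (fun _ _ _ _ _ => rfl)
    (Finset.subset_univ K)
  simpa using h

lemma charSum_eq_sum_fiber (v : Fin n → ZMod 4) :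
    charSum 4 n ![r, s, r, s] v = ∑ D : Finset (Fin n),
      ZMod.stdAddChar (v ⬝ᵥ fun j => if j ∈ D then 1 else 0) *
        ((∑ x ∈ (typeFinset n ![r, s, r, s]).filter (fun x => oddSet x = D),
          ∏ j ∈ oddSet v, upperSign (x j) : ℝ) : ℂ) := by
  rw [charSum_eq_sum_typeFinset, ← Finset.sum_fiberwise _ oddSet]
  refine Finset.sum_congr rfl fun D _ => ?_
  rw [Complex.ofReal_sum, Finset.mul_sum]
  refine Finset.sum_congr rfl fun x hx => ?_
  rw [stdAddChar_dotProduct_eq, (Finset.mem_filter.1 hx).2]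

/-- The character sum is dominated by a central Krawtchouk value at the number of odd entries. -/
lemma norm_charSum_le (v : Fin n → ZMod 4) :
    ‖charSum 4 n ![r, s, r, s] v‖ ≤
      ((typeFinset n ![r, s, r, s]).card : ℝ) * |krawtchoukSeq n 0 (oddSet v).card| := by
  set K := oddSet v with hK
  set B : Finset (Fin n) → ℝ := fun D =>
    ∑ x ∈ (typeFinset n ![r, s, r, s]).filter (fun x => oddSet x = D), ∏ j ∈ K, upperSign (x j)
    with hB
  have hle : ‖charSum 4 n ![r, s, r, s] v‖ ≤ ∑ D, |B D| := by
    rw [charSum_eq_sum_fiber]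
    refine (norm_sum_le _ _).trans (Finset.sum_le_sum fun D _ => ?_)
    rw [norm_mul, norm_stdAddChar, one_mul, Complex.norm_real, Real.norm_eq_abs]
  have htot : ∑ D, B D = ((typeFinset n ![r, s, r, s]).card : ℝ) * krawtchoukSeq n 0 K.card := by
    rw [← sum_upperSign, ← Finset.sum_fiberwise _ oddSet]
  have hcard : ∀ D : Finset (Fin n), (K \ D).card + (K ∩ D).card = K.card := fun D =>
    Finset.card_sdiff_add_card_inter K D
  refine hle.trans ?_
  rcases Nat.even_or_odd' K.card with ⟨m, hm | hm⟩
  -- All fiber sums share the sign (-1)^m, so the sum of their absolute values is the absolute value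
  -- of their sum.
  · have hpos : ∀ D, 0 ≤ (-1) ^ m * B D := by
      intro D
      rw [hB]
      simp only
      rw [sum_upperSign_fiber, mul_left_comm]
      refine mul_nonneg (Nat.cast_nonneg _) (krawtchoukSeq_zero_mul_sign ?_ ?_ ?_)
      · exact_mod_cast Finset.card_le_card fun l hl =>
          Finset.mem_compl.2 (Finset.mem_sdiff.1 hl).2
      · exact_mod_cast Finset.card_le_card Finset.inter_subset_right
      · rw [hcard, hm]
    have habs : ∀ D, |B D| = (-1) ^ m * B D := by
      intro D
      rw [← abs_of_nonneg (hpos D), abs_mul, abs_pow, abs_neg, abs_one, one_pow, one_mul]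
    rw [Finset.sum_congr rfl fun D _ => habs D, ← Finset.mul_sum, htot]
    refine (le_abs_self _).trans_eq ?_
    rw [abs_mul, abs_mul, abs_pow, abs_neg, abs_one, one_pow, one_mul, Nat.abs_cast]
  · have hzero : ∀ D, B D = 0 := by
      intro D
      rw [hB]
      simp only
      rw [sum_upperSign_fiber, krawtchoukSeq_zero_mul_of_odd, mul_zero]
      rw [hcard]
      exact ⟨m, hm⟩
    simp only [hzero, abs_zero, Finset.sum_const_zero]
    positivity

end BalancedType

/-! ### Even vectors, duality and the minimum -/

section MinimalEigenvalue

open Matrix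

variable {n r s : ℕ}

lemma card_oddSet {x : Fin n → ZMod 4} (hx : x ∈ typeFinset n ![r, s, r, s]) :
    (oddSet x).card = 2 * s := by
  have n0 : ¬ ((0 : ZMod 4) = 1 ∨ (0 : ZMod 4) = 3) := by decide
  have n2 : ¬ ((2 : ZMod 4) = 1 ∨ (2 : ZMod 4) = 3) := by decide
  rw [oddSet, Finset.card_filter,
    sum_comp_of_mem_balanced (fun a => if a = 1 ∨ a = 3 then 1 else 0) hx]
  simp only [if_neg n0, if_neg n2]
  simp
  ring

lemma sum_paritySign (T : Finset (Fin n)) :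
    ∑ x ∈ typeFinset n ![r, s, r, s], ∏ j ∈ T, paritySign (x j) =
      ((typeFinset n ![r, s, r, s]).card : ℝ) * krawtchoukSeq n (2 * r - 2 * s) T.card := by
  have h := exchangeable_sum_eq (Ω := typeFinset n ![r, s, r, s]) (w := fun _ => 1)
    (U := Finset.univ) (c := 2 * r - 2 * s) (K := T) paritySign_mul_self
    (by
      intro x hx
      rw [sum_comp_of_mem_balanced paritySign hx, paritySign_zero, paritySign_one, paritySign_two,
        paritySign_three]
      simp only [nsmul_eq_mul]
      ring)
    (fun i _ j _ x hx => comp_equiv_mem_typeFinset _ hx) (fun _ _ _ _ _ => rfl)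
    (Finset.subset_univ T)
  simpa using h

lemma sum_twoSign {t : ℕ} (ht : t ≤ n) (D : Finset (Fin n)) :
    ∑ v ∈ typeFinset n ![n - t, 0, t, 0], ∏ j ∈ D, twoSign (v j) =
      ((typeFinset n ![n - t, 0, t, 0]).card : ℝ) * krawtchoukSeq n (n - 2 * t) D.card := by
  have h := exchangeable_sum_eq (Ω := typeFinset n ![n - t, 0, t, 0]) (w := fun _ => 1)
    (U := Finset.univ) (c := n - 2 * t) (K := D) twoSign_mul_self
    (by
      intro v hv
      rw [sum_comp_of_mem_typeFinset twoSign hv, twoSign_zero, twoSign_one, twoSign_two,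
        twoSign_three]
      simp [Nat.cast_sub ht]
      ring)
    (fun i _ j _ x hx => comp_equiv_mem_typeFinset _ hx) (fun _ _ _ _ _ => rfl)
    (Finset.subset_univ D)
  simpa using h

lemma mem_typeFinset_of_even {v : Fin n → ZMod 4} (hv : ∀ j, v j = 0 ∨ v j = 2) :
    v ∈ typeFinset n ![n - hammingWt 2 v, 0, hammingWt 2 v, 0] := by
  have n1 : ¬ ((0 : ZMod 4) = 1) ∧ ¬ ((2 : ZMod 4) = 1) := by decide
  have n3 : ¬ ((0 : ZMod 4) = 3) ∧ ¬ ((2 : ZMod 4) = 3) := by decide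
  rw [mem_typeFinset]
  intro k
  fin_cases k
  · change hammingWt 0 v = n - hammingWt 2 v
    have h : hammingWt 2 v + hammingWt 0 v = n := by
      unfold hammingWt
      have h1 : (Finset.univ.filter fun i => v i = 0) =
          Finset.univ.filter fun i => ¬ v i = 2 := by
        ext i
        have h02 : ¬ ((0 : ZMod 4) = 2) := by decide
        have h20 : ¬ ((2 : ZMod 4) = 0) := by decide
        rcases hv i with h | h <;> simp [h, h02, h20]
      rw [h1, Finset.card_filter_add_card_filter_not, Finset.card_univ, Fintype.card_fin]
    omega
  · change hammingWt 1 v = 0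
    unfold hammingWt
    rw [Finset.card_eq_zero, Finset.filter_eq_empty_iff]
    intro j _
    rcases hv j with h | h <;> rw [h]
    exacts [n1.1, n1.2]
  · rfl
  · change hammingWt 3 v = 0
    unfold hammingWt
    rw [Finset.card_eq_zero, Finset.filter_eq_empty_iff]
    intro j _
    rcases hv j with h | h <;> rw [h]
    exacts [n3.1, n3.2]

lemma even_of_mem_typeFinset {a t : ℕ} {v : Fin n → ZMod 4} (hv : v ∈ typeFinset n ![a, 0, t, 0])
    (j : Fin n) : v j = 0 ∨ v j = 2 := by
  rw [mem_typeFinset] at hv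
  have h1 : hammingWt 1 v = 0 := hv 1
  have h3 : hammingWt 3 v = 0 := hv 3
  unfold hammingWt at h1 h3
  rw [Finset.card_eq_zero, Finset.filter_eq_empty_iff] at h1 h3
  rcases zmod_four_cases (v j) with h | h | h | h
  · exact Or.inl h
  · exact absurd h (h1 (Finset.mem_univ j))
  · exact Or.inr h
  · exact absurd h (h3 (Finset.mem_univ j))

/-- At vectors with even entries, the character sum is a Krawtchouk value; the duality of
Krawtchouk values comes from averaging over all such vectors with the same number of twos. -/
lemma charSum_of_even {v : Fin n → ZMod 4} (hv : ∀ j, v j = 0 ∨ v j = 2) :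
    charSum 4 n ![r, s, r, s] v =
      ((((typeFinset n ![r, s, r, s]).card : ℝ) *
        krawtchoukSeq n (n - 2 * hammingWt 2 v) (2 * s) : ℝ) : ℂ) := by
  set t := hammingWt 2 v with ht
  set S := typeFinset n ![r, s, r, s] with hS
  set Ω := typeFinset n ![n - t, 0, t, 0] with hΩ
  have hvΩ : v ∈ Ω := mem_typeFinset_of_even hv
  have htn : t ≤ n := by
    rw [ht, hammingWt]
    exact (Finset.card_le_univ _).trans_eq (Fintype.card_fin n)
  -- Computed through the parities of x, λ is constant on the even vectors with t twos; `hsum`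
  -- computes the same total by first averaging over those vectors, which exchanges degree and
  -- argument.
  have hconst : ∀ u ∈ Ω, charSum 4 n ![r, s, r, s] u =
      (((S.card : ℝ) * krawtchoukSeq n (2 * r - 2 * s) t : ℝ) : ℂ) := by
    intro u hu
    have hcard : (Finset.univ.filter fun j => u j = 2).card = t :=
      (mem_typeFinset.1 hu) 2
    rw [← hcard, ← sum_paritySign, Complex.ofReal_sum, charSum_eq_sum_typeFinset]
    exact Finset.sum_congr rfl fun x _ =>
      stdAddChar_dotProduct_eq_paritySign (even_of_mem_typeFinset hu) x
  have hsum : ∑ u ∈ Ω, charSum 4 n ![r, s, r, s] u =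
      (((Ω.card : ℝ) * ((S.card : ℝ) * krawtchoukSeq n (n - 2 * t) (2 * s)) : ℝ) : ℂ) := by
    simp_rw [charSum_eq_sum_typeFinset]
    rw [Finset.sum_comm]
    have : ∀ x ∈ S, ∑ u ∈ Ω, ZMod.stdAddChar (u ⬝ᵥ x) =
        (((Ω.card : ℝ) * krawtchoukSeq n (n - 2 * t) (2 * s) : ℝ) : ℂ) := by
      intro x hx
      rw [← card_oddSet hx, ← sum_twoSign htn, Complex.ofReal_sum]
      exact Finset.sum_congr rfl fun u hu =>
        stdAddChar_dotProduct_eq_twoSign (even_of_mem_typeFinset hu) x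
    rw [Finset.sum_congr rfl this, Finset.sum_const, nsmul_eq_mul]
    push_cast
    ring
  rw [Finset.sum_congr rfl hconst, Finset.sum_const, nsmul_eq_mul] at hsum
  have hΩ0 : (Ω.card : ℂ) ≠ 0 := by
    exact_mod_cast (Finset.card_pos.2 ⟨v, hvΩ⟩).ne'
  rw [Complex.ofReal_mul (Ω.card : ℝ), Complex.ofReal_natCast] at hsum
  rw [hconst v hvΩ]
  exact mul_left_cancel₀ hΩ0 hsum

lemma oddSet_add_one (v : Fin n → ZMod 4) : oddSet (v + fun _ => 1) = (oddSet v)ᶜ := by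
  ext j
  rw [Finset.mem_compl, mem_oddSet, mem_oddSet, Pi.add_apply]
  generalize v j = a
  revert a
  decide

lemma charSum_re_lower_bound (hn : n = 2 * (r + s)) (hs : 1 ≤ s) (hr : Even r)
    (hK : ∀ z : ℝ, |z| ≤ n → -(1 / ((n : ℝ) - 1)) ≤ krawtchoukSeq n z (2 * s))
    (v : Fin n → ZMod 4) :
    -((typeFinset n ![r, s, r, s]).card : ℝ) / ((n : ℝ) - 1) ≤
      (charSum 4 n ![r, s, r, s] v).re := by
  -- Adding the all-ones vector preserves λ and complements the set of odd coordinates.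
  wlog hle : 2 * (oddSet v).card ≤ n generalizing v
  · have h := this (v + fun _ => 1) (by
      rw [oddSet_add_one, Finset.card_compl, Fintype.card_fin]; omega)
    rwa [charSum_add_const hr] at h
  set M : ℝ := ((typeFinset n ![r, s, r, s]).card : ℝ) with hM
  have hM0 : 0 ≤ M := Nat.cast_nonneg _
  have hn1 : (1 : ℝ) < n := by exact_mod_cast (by omega : 1 < n)
  have hgoal : -M / ((n : ℝ) - 1) = M * -(1 / ((n : ℝ) - 1)) := by ring
  rw [hgoal]
  rcases Nat.even_or_odd' (oddSet v).card with ⟨m, hm | hm⟩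
  · rcases Nat.eq_zero_or_pos m with rfl | hmpos
    · have hv : ∀ j, v j = 0 ∨ v j = 2 := by
        rw [mul_zero, Finset.card_eq_zero] at hm
        intro j
        have hj : j ∉ oddSet v := by rw [hm]; exact Finset.notMem_empty j
        rw [mem_oddSet] at hj
        rcases zmod_four_cases (v j) with h | h | h | h <;> simp_all
      have ht : (hammingWt 2 v : ℝ) ≤ n := by
        have : hammingWt 2 v ≤ n := (Finset.card_le_univ _).trans_eq (Fintype.card_fin n)
        exact_mod_cast this
      have ht0 : (0 : ℝ) ≤ hammingWt 2 v := Nat.cast_nonneg _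
      rw [charSum_of_even hv, Complex.ofReal_re]
      exact mul_le_mul_of_nonneg_left (hK _ (abs_le.2 ⟨by linarith, by linarith⟩)) hM0
    · have hmn : (4 * m : ℝ) ≤ n := by exact_mod_cast (by omega : 4 * m ≤ n)
      have h1 := norm_charSum_le (r := r) (s := s) v
      rw [hm] at h1
      have h2 := mul_le_mul_of_nonneg_left (abs_krawtchoukSeq_zero_even_le n m hmpos hmn) hM0
      have h3 := neg_le_of_abs_le (Complex.abs_re_le_norm (charSum 4 n ![r, s, r, s] v))
      linarith
  · have h1 := norm_charSum_le (r := r) (s := s) v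
    rw [hm, krawtchoukSeq_zero_odd, abs_zero, mul_zero] at h1
    have h3 := neg_le_of_abs_le (Complex.abs_re_le_norm (charSum 4 n ![r, s, r, s] v))
    have h4 : 0 ≤ M * (1 / ((n : ℝ) - 1)) :=
      mul_nonneg hM0 (one_div_nonneg.2 (by linarith))
    linarith

/-- Mod 4, 3 = 1 + 2 and 1 = -1 + 2: subtracting the constant 2 leaves 1 at the entry equal to 3, -1
at the entry equal to 1, and 0 elsewhere. -/
lemma eq_single_sub_single_add_two {v : Fin n → ZMod 4}
    (hv : v ∈ vectorsOfType 4 n ![0, 1, n - 2, 1]) :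
    ∃ a b : Fin n, a ≠ b ∧ v = (Pi.single a 1 - Pi.single b 1) + fun _ => 2 := by
  have h0 : hammingWt 0 v = 0 := hv 0
  have h1 : hammingWt 1 v = 1 := hv 1
  have h3 : hammingWt 3 v = 1 := hv 3
  unfold hammingWt at h0 h1 h3
  rw [Finset.card_eq_zero, Finset.filter_eq_empty_iff] at h0
  obtain ⟨b, hb⟩ := Finset.card_eq_one.1 h1
  obtain ⟨a, ha⟩ := Finset.card_eq_one.1 h3
  have hb' : ∀ j, v j = 1 ↔ j = b := fun j => by
    have := Finset.ext_iff.1 hb j; simpa using this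
  have ha' : ∀ j, v j = 3 ↔ j = a := fun j => by
    have := Finset.ext_iff.1 ha j; simpa using this
  have hab : a ≠ b := by
    rintro rfl
    have := ((ha' a).2 rfl).symm.trans ((hb' a).2 rfl)
    exact absurd this (by decide)
  refine ⟨a, b, hab, funext fun j => ?_⟩
  rw [Pi.add_apply, Pi.sub_apply]
  by_cases hja : j = a
  · subst hja
    rw [(ha' j).2 rfl, Pi.single_eq_same, Pi.single_eq_of_ne hab]
    decide
  by_cases hjb : j = b
  · subst hjb
    rw [(hb' j).2 rfl, Pi.single_eq_same, Pi.single_eq_of_ne hja]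
    decide
  rw [Pi.single_eq_of_ne hja, Pi.single_eq_of_ne hjb, sub_self, zero_add]
  rcases zmod_four_cases (v j) with h | h | h | h
  · exact absurd h (h0 (Finset.mem_univ j))
  · exact absurd ((hb' j).1 h) hjb
  · exact h
  · exact absurd ((ha' j).1 h) hja

/-- The conclusion of the main theorem, given a lower bound on one Krawtchouk sequence. -/
lemma minimal_eigenvalue_of_krawtchoukSeq_lower (hn : n = 2 * (r + s)) (hs : 1 ≤ s) (hr : Even r)
    (hK : ∀ z : ℝ, |z| ≤ n → -(1 / ((n : ℝ) - 1)) ≤ krawtchoukSeq n z (2 * s)) :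
    IsLeast (graphEigenvalues (typeCayley 4 n ![r, s, r, s]))
        (-(Nat.multinomial Finset.univ ![r, s, r, s] : ℝ) / ((n : ℝ) - 1)) ∧
      (vectorsOfType 4 n ![0, 1, n - 2, 1]).Nonempty ∧
      ∀ v ∈ vectorsOfType 4 n ![0, 1, n - 2, 1],
        charSum 4 n ![r, s, r, s] v =
          ((-(Nat.multinomial Finset.univ ![r, s, r, s] : ℝ) / ((n : ℝ) - 1) : ℝ) : ℂ) := by
  have hcard : (typeFinset n ![r, s, r, s]).card = Nat.multinomial Finset.univ ![r, s, r, s] :=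
    card_typeFinset (by change r + s + r + s = n; omega)
  have hval : ∀ v ∈ vectorsOfType 4 n ![0, 1, n - 2, 1],
      charSum 4 n ![r, s, r, s] v =
        ((-(Nat.multinomial Finset.univ ![r, s, r, s] : ℝ) / ((n : ℝ) - 1) : ℝ) : ℂ) := by
    intro v hv
    obtain ⟨a, b, hab, rfl⟩ := eq_single_sub_single_add_two hv
    rw [charSum_add_const hr, charSum_single_sub_single hab, hcard]
  have hne : (vectorsOfType 4 n ![0, 1, n - 2, 1]).Nonempty := by
    have h : 0 < (typeFinset n ![0, 1, n - 2, 1]).card := by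
      rw [card_typeFinset (by change 0 + 1 + (n - 2) + 1 = n; omega)]
      exact Nat.multinomial_pos _ _
    obtain ⟨v, hv⟩ := Finset.card_pos.1 h
    exact ⟨v, mem_typeFinset.1 hv⟩
  have hneg : ∀ x ∈ vectorsOfType 4 n ![r, s, r, s], -x ∈ vectorsOfType 4 n ![r, s, r, s] :=
    fun _ hx => neg_mem_vectorsOfType hx
  refine ⟨⟨?_, ?_⟩, hne, hval⟩
  · obtain ⟨v, hv⟩ := hne
    exact mem_graphEigenvalues_of_charSum_eq hneg (zero_notMem_vectorsOfType hs) (hval v hv)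
  · intro μ hμ
    obtain ⟨v, hv⟩ :=
      exists_charSum_eq_of_mem_graphEigenvalues hneg (zero_notMem_vectorsOfType hs) hμ
    have h := charSum_re_lower_bound hn hs hr hK v
    rwa [hv, Complex.ofReal_re, hcard] at h

end MinimalEigenvalue

theorem mainTheorem1 :
    -- (R1): `s ≥ 2` fixed and `n` large enough
    (∀ s : ℕ, 2 ≤ s → ∃ N : ℕ, ∀ n r : ℕ, n = 2 * (r + s) → s ≤ r → Even r → N ≤ n →
      IsLeast (graphEigenvalues (typeCayley 4 n ![r, s, r, s]))
        (-(Nat.multinomial Finset.univ ![r, s, r, s] : ℝ) / ((n : ℝ) - 1)) ∧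
      (vectorsOfType 4 n ![0, 1, n - 2, 1]).Nonempty ∧
      ∀ v ∈ vectorsOfType 4 n ![0, 1, n - 2, 1],
        charSum 4 n ![r, s, r, s] v =
          ((-(Nat.multinomial Finset.univ ![r, s, r, s] : ℝ) / ((n : ℝ) - 1) : ℝ) : ℂ)) ∧
    -- (R2): `s = α n / 2` with `0 < α ≤ 0.17` fixed and `n` large enough
    (∀ α : ℝ, 0 < α → α ≤ 0.17 → ∃ N : ℕ, ∀ n r s : ℕ, n = 2 * (r + s) → s ≤ r → Even r →
      (s : ℝ) = α * ((n : ℝ) / 2) → N ≤ n →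
      IsLeast (graphEigenvalues (typeCayley 4 n ![r, s, r, s]))
        (-(Nat.multinomial Finset.univ ![r, s, r, s] : ℝ) / ((n : ℝ) - 1)) ∧
      (vectorsOfType 4 n ![0, 1, n - 2, 1]).Nonempty ∧
      ∀ v ∈ vectorsOfType 4 n ![0, 1, n - 2, 1],
        charSum 4 n ![r, s, r, s] v =
          ((-(Nat.multinomial Finset.univ ![r, s, r, s] : ℝ) / ((n : ℝ) - 1) : ℝ) : ℂ)) := by
  refine ⟨fun s hs => ?_, fun α hα hα' => ?_⟩
  · obtain ⟨N, hN⟩ := exists_krawtchoukSeq_lower_fixed s hs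
    exact ⟨N, fun n r hn _ hr hNn =>
      minimal_eigenvalue_of_krawtchoukSeq_lower hn (by omega) hr (hN n hNn)⟩
  · obtain ⟨N, hN⟩ := exists_krawtchoukSeq_lower_linear α hα hα'
    -- The extra 1 forces n > 0, hence s = αn/2 > 0.
    refine ⟨N + 1, fun n r s hn _ hr hs hNn =>
      minimal_eigenvalue_of_krawtchoukSeq_lower hn ?_ hr (hN n s hs (by omega))⟩
    have hnpos : (0 : ℝ) < n := by exact_mod_cast (by omega : 0 < n)
    have hspos : (0 : ℝ) < s := by rw [hs]; positivity
    exact_mod_cast hspos
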